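/- Let $K$ be a real Hilbert space, $\mathcal L(K)$ the Banach space of bounded linear operators on $K$ with the operator norm, and $\mathcal I(K)=\{Q\in\mathcal L(K): Q^2=Q,\ Q\neq 0,\ Q\neq I\}$. Let $\mathscr G(K)$ be the Grassmann manifold of $K$: the set of all non-zero proper complemented subspaces of $K$, with the real analytic Banach manifold structure given by the charts $(I+T)(E_0)\mapsto T\in\mathcal L(E_0,F_0)$, one for each pair $E_0,F_0\in\mathscr G(K)$ of mutually complementary subspaces, the domain of this chart being the set of all complements of $F_0$. Let $\mathbf T(\mathscr G(K))$ be the total space of its tangent bundle, with its real analytic Banach manifold structure. For $E\in\mathscr G(K)$ the tangent plane at $E$ is identified with $\mathcal L(E,E^\perp)$: the operator $T$ corresponds to the tangent vector whose coordinate in the chart of the pair $(E,E^\perp)$ is $T$ (the velocity at $s=0$ of the curve $s\mapsto (I+sT)(E)$). Thus the points of $\mathbf T(\mathscr G(K))$ are the pairs $(E,T)$ with $E\in\mathscr G(K)$ and $T\in\mathcal L(E,E^\perp)$. **Theorem.** The set $\mathcal I(K)$ is a real analytic Banach submanifold of $\mathcal L(K)$. When it is equipped with the induced manifold structure, the assignment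 $$(E,T)\longmapsto T^*\circ \bar P_{E^\perp}+P_E ,$$ where $T^*:E^\perp\to E$ is the adjoint of $T$, $\bar P_{E^\perp}:K\to E^\perp$ is the orthogonal projection regarded as a map onto $E^\perp$, and $P_E\in\mathcal L(K)$ is the orthogonal projection onto $E$, is a bijection from $\mathbf T(\mathscr G(K))$ onto $\mathcal I(K)$ which is real analytic and has a real analytic inverse. For every $E\in\mathscr G(K)$ it restricts to an affine map from the tangent plane at $E$ onto $\{Q\in\mathcal I(K): Q(K)=E\}$. -/

import Mathlib

open Topology

universe u

noncomputable section

/-! Real analytic Banach manifolds. -/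

/-- A real analytic Banach manifold structure on a set `M`, given by an analytic atlas: a family of
bijections from subsets of `M` onto open subsets of real Banach spaces (which may vary from chart to
chart) whose domains cover `M`, with open overlaps and analytic changes of coordinates.
The topology of `M` is the one making all charts homeomorphisms onto open sets; note that
`isOpen_overlap i i` says that the target of the chart `i` is open. -/
structure AnalyticAtlas (M : Type u) where
  Index : Type u
  Model : Index → Type u
  [normedAddCommGroup : ∀ i, NormedAddCommGroup (Model i)]
  [normedSpace : ∀ i, NormedSpace ℝ (Model i)]
  [completeSpace : ∀ i, CompleteSpace (Model i)]
  chart : ∀ i, PartialEquiv M (Model i)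
  exists_chart : ∀ p, ∃ i, p ∈ (chart i).source
  isOpen_overlap : ∀ i j, IsOpen ((chart i).symm.trans (chart j)).source
  analytic : ∀ i j, AnalyticOnNhd ℝ ((chart i).symm.trans (chart j))
    ((chart i).symm.trans (chart j)).source

attribute [instance] AnalyticAtlas.normedAddCommGroup AnalyticAtlas.normedSpace
  AnalyticAtlas.completeSpace

namespace AnalyticAtlas

variable {M : Type u} {N : Type u}

/-- `f : M → N` is analytic: around every point it is continuous and has local power series
expansions when it is read in charts of `M` and of `N`. -/
def IsAnalyticMap (A : AnalyticAtlas M) (B : AnalyticAtlas N) (f : M → N) : Prop :=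
  ∀ (p : M) (i : A.Index) (j : B.Index), p ∈ (A.chart i).source → f p ∈ (B.chart j).source →
    (∀ᶠ x in 𝓝 (A.chart i p), f ((A.chart i).symm x) ∈ (B.chart j).source) ∧
    AnalyticAt ℝ (fun x => B.chart j (f ((A.chart i).symm x))) (A.chart i p)

variable (A : AnalyticAtlas M)

/-- The change of coordinates from the chart `i` to the chart `j`. -/
def transition (i j : A.Index) : A.Model i → A.Model j :=
  fun x => A.chart j ((A.chart i).symm x)

/-- The tangent space at `p`: a tangent vector assigns to every chart around `p` a vector of the
model space of this chart, in such a way that these vectors correspond to one another under the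
derivatives of the changes of coordinates. -/
def TangentSpace (p : M) :
    Submodule ℝ (∀ i : {i : A.Index // p ∈ (A.chart i).source}, A.Model i.1) where
  carrier := {v | ∀ i j, v j = fderiv ℝ (A.transition i.1 j.1) (A.chart i.1 p) (v i)}
  zero_mem' := by intro i j; simp
  add_mem' := by
    intro v w hv hw i j
    simp [hv i j, hw i j]
  smul_mem' := by
    intro c v hv i j
    simp [hv i j]

/-- The total space of the tangent bundle. -/
def TangentBundle : Type u := Σ p : M, A.TangentSpace p

variable {A}

theorem mem_overlap {i j : A.Index} {p : M} (hi : p ∈ (A.chart i).source)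
    (hj : p ∈ (A.chart j).source) :
    A.chart i p ∈ ((A.chart i).symm.trans (A.chart j)).source := by
  simp [PartialEquiv.trans_source, hi, hj]

theorem analyticAt_transition {i j : A.Index} {p : M} (hi : p ∈ (A.chart i).source)
    (hj : p ∈ (A.chart j).source) : AnalyticAt ℝ (A.transition i j) (A.chart i p) :=
  A.analytic i j _ (mem_overlap hi hj)

theorem fderiv_transition_self {i : A.Index} {p : M} (hi : p ∈ (A.chart i).source) :
    fderiv ℝ (A.transition i i) (A.chart i p) = ContinuousLinearMap.id ℝ _ := by
  have h : A.transition i i =ᶠ[𝓝 (A.chart i p)] id := by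
    filter_upwards [(A.isOpen_overlap i i).mem_nhds (mem_overlap hi hi)] with x hx
    simp only [PartialEquiv.trans_source, PartialEquiv.symm_source, Set.mem_inter_iff] at hx
    exact (A.chart i).right_inv hx.1
  rw [h.fderiv_eq, fderiv_id]

theorem fderiv_transition_comp {i j k : A.Index} {p : M} (hi : p ∈ (A.chart i).source)
    (hj : p ∈ (A.chart j).source) (hk : p ∈ (A.chart k).source) (v : A.Model i) :
    fderiv ℝ (A.transition i k) (A.chart i p) v =
      fderiv ℝ (A.transition j k) (A.chart j p)
        (fderiv ℝ (A.transition i j) (A.chart i p) v) := by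
  have h : A.transition i k =ᶠ[𝓝 (A.chart i p)] A.transition j k ∘ A.transition i j := by
    filter_upwards [(A.isOpen_overlap i j).mem_nhds (mem_overlap hi hj)] with x hx
    simp only [PartialEquiv.trans_source, PartialEquiv.symm_source, Set.mem_inter_iff,
      Set.mem_preimage] at hx
    simp [transition, (A.chart j).left_inv hx.2]
  have e : A.transition i j (A.chart i p) = A.chart j p := by
    simp [transition, (A.chart i).left_inv hi]
  have hjk := (analyticAt_transition hj hk).differentiableAt
  rw [← e] at hjk
  rw [h.fderiv_eq, fderiv_comp _ hjk (analyticAt_transition hi hj).differentiableAt, e]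
  rfl

variable (A)

/-- The coordinate in the chart `i` identifies the tangent space at a point of the domain of this
chart with the model space. -/
def tangentCoord (i : A.Index) {p : M} (hi : p ∈ (A.chart i).source) :
    A.TangentSpace p ≃ₗ[ℝ] A.Model i where
  toFun v := v.1 ⟨i, hi⟩
  map_add' _ _ := rfl
  map_smul' _ _ := rfl
  invFun w := ⟨fun j => fderiv ℝ (A.transition i j.1) (A.chart i p) w,
    fun j k => fderiv_transition_comp hi j.2 k.2 w⟩
  left_inv v := by
    apply Subtype.ext
    funext j
    exact (v.2 ⟨i, hi⟩ j).symm
  right_inv w := by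
    simp [fderiv_transition_self hi]

open Classical in
/-- The chart of the tangent bundle induced by the chart `i` of the manifold: `(p, v)` is sent to
the coordinates of `p` and of `v`. -/
def tangentChart (i : A.Index) : PartialEquiv A.TangentBundle (A.Model i × A.Model i) where
  toFun x := (A.chart i x.1,
    if h : x.1 ∈ (A.chart i).source then A.tangentCoord i h x.2 else 0)
  invFun y := ⟨(A.chart i).symm y.1,
    if h : (A.chart i).symm y.1 ∈ (A.chart i).source then (A.tangentCoord i h).symm y.2 else 0⟩
  source := {x | x.1 ∈ (A.chart i).source}
  target := (A.chart i).target ×ˢ Set.univ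
  map_source' x hx := by
    have hx : x.1 ∈ (A.chart i).source := hx
    simp [hx]
  map_target' y hy := (A.chart i).map_target hy.1
  left_inv' := by
    rintro ⟨p, v⟩ hp
    have hp : p ∈ (A.chart i).source := hp
    have key : ∀ q : M, ∀ e : q = p,
        (⟨q, if h : q ∈ (A.chart i).source then
          (A.tangentCoord i h).symm (A.tangentCoord i hp v) else 0⟩ : Σ p : M, A.TangentSpace p)
          = ⟨p, v⟩ := by
      rintro q rfl
      simp [hp]
    have := key _ ((A.chart i).left_inv hp)
    simp only [hp, dif_pos]
    exact this
  right_inv' := by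
    rintro ⟨a, w⟩ h
    have ha : a ∈ (A.chart i).target := h.1
    have hs : (A.chart i).symm a ∈ (A.chart i).source := (A.chart i).map_target ha
    simp [hs, (A.chart i).right_inv ha]

theorem tangentChart_overlap (i j : A.Index) :
    ((A.tangentChart i).symm.trans (A.tangentChart j)).source =
      ((A.chart i).symm.trans (A.chart j)).source ×ˢ Set.univ := by
  ext ⟨a, w⟩
  rw [PartialEquiv.trans_source, PartialEquiv.trans_source]
  change ((a ∈ (A.chart i).target ∧ _) ∧ (A.chart i).symm a ∈ (A.chart j).source) ↔
    (a ∈ (A.chart i).target ∧ (A.chart i).symm a ∈ (A.chart j).source) ∧ _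
  simp

open Classical in
theorem tangentChart_transition (i j : A.Index) (y : A.Model i × A.Model i)
    (hy : y.1 ∈ ((A.chart i).symm.trans (A.chart j)).source) :
    ((A.tangentChart i).symm.trans (A.tangentChart j)) y =
      (A.transition i j y.1, fderiv ℝ (A.transition i j) y.1 y.2) := by
  simp only [PartialEquiv.trans_source, PartialEquiv.symm_source, Set.mem_inter_iff,
    Set.mem_preimage] at hy
  have hs := (A.chart i).map_target hy.1
  have e : A.tangentCoord j hy.2 ((A.tangentCoord i hs).symm y.2) =
      fderiv ℝ (A.transition i j) (A.chart i ((A.chart i).symm y.1)) y.2 := rfl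
  rw [(A.chart i).right_inv hy.1] at e
  change A.tangentChart j ⟨(A.chart i).symm y.1, if h : (A.chart i).symm y.1 ∈ (A.chart i).source
    then (A.tangentCoord i h).symm y.2 else 0⟩ = _
  rw [dif_pos hs, ← e]
  change (_, if h : (A.chart i).symm y.1 ∈ (A.chart j).source then _ else _) = _
  rw [dif_pos hy.2]
  rfl

/-- The analytic Banach manifold structure of the total space of the tangent bundle. -/
def tangentAtlas : AnalyticAtlas A.TangentBundle where
  Index := A.Index
  Model i := A.Model i × A.Model i
  chart i := A.tangentChart i
  exists_chart x := A.exists_chart x.1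
  isOpen_overlap i j := by
    rw [tangentChart_overlap]
    exact (A.isOpen_overlap i j).prod isOpen_univ
  analytic i j := by
    intro y hy
    rw [tangentChart_overlap] at hy
    have ho := ((A.isOpen_overlap i j).prod (isOpen_univ (X := A.Model i))).mem_nhds hy
    have ht : AnalyticAt ℝ (A.transition i j) y.1 := A.analytic i j _ hy.1
    have h1 : AnalyticAt ℝ (fun z : A.Model i × A.Model i => A.transition i j z.1) y :=
      ht.comp_of_eq analyticAt_fst rfl
    have h2 : AnalyticAt ℝ (fun z : A.Model i × A.Model i =>
        fderiv ℝ (A.transition i j) z.1 z.2) y :=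
      ((ContinuousLinearMap.id ℝ (A.Model i →L[ℝ] A.Model j)).analyticAt_bilinear _).comp_of_eq
        ((ht.fderiv.comp_of_eq analyticAt_fst rfl).prod analyticAt_snd) rfl
    refine (h1.prod h2).congr ?_
    filter_upwards [ho] with z hz
    exact (A.tangentChart_transition i j z hz.1).symm

end AnalyticAtlas

/-! Analytic submanifolds of a Banach space. -/

section Submanifold

variable {Y : Type u} [NormedAddCommGroup Y] [NormedSpace ℝ Y]

/-- A chart of the Banach space `Y` that flattens the subset `S` around one of its points `base`: a
bi-analytic map `Φ` from an open neighbourhood of `base` onto an open subset of `Y` which maps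
the points of `S`, and only these, into a closed subspace `V` of `Y`. The subspace is complemented:
`proj` is a continuous linear projection of `Y` onto `V`. -/
structure SliceChart (S : Set Y) where
  base : S
  Φ : OpenPartialHomeomorph Y Y
  base_mem : (base : Y) ∈ Φ.source
  analytic : AnalyticOnNhd ℝ Φ Φ.source
  analytic_symm : AnalyticOnNhd ℝ Φ.symm Φ.target
  V : Submodule ℝ Y
  proj : Y →L[ℝ] V
  proj_coe : ∀ v : V, proj v = v
  mem_iff : ∀ y ∈ Φ.source, y ∈ S ↔ Φ y ∈ V

/-- `S` is an analytic Banach submanifold of the Banach space `Y`. -/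
def IsAnalyticSubmanifold (S : Set Y) : Prop :=
  ∀ x : S, ∃ c : SliceChart S, c.base = x

namespace SliceChart

variable {S : Set Y}

theorem isClosed_V (c : SliceChart S) : IsClosed (c.V : Set Y) :=
  Submodule.ClosedComplemented.isClosed ⟨c.proj, c.proj_coe⟩

theorem symm_mem (c : SliceChart S) {v : c.V} (hv : (v : Y) ∈ c.Φ.target) :
    c.Φ.symm v ∈ S := by
  rw [c.mem_iff _ (c.Φ.map_target hv), c.Φ.right_inv hv]
  exact v.2

theorem coe_proj (c : SliceChart S) {x : Y} (hx : x ∈ S) (h : x ∈ c.Φ.source) :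
    (c.proj (c.Φ x) : Y) = c.Φ x :=
  congrArg Subtype.val (c.proj_coe ⟨c.Φ x, (c.mem_iff x h).1 hx⟩)

open Classical in
/-- The chart of `S` with values in `V` obtained by restricting `Φ`. -/
def chart (c : SliceChart S) : PartialEquiv S c.V where
  toFun x := c.proj (c.Φ x)
  invFun v := if h : (v : Y) ∈ c.Φ.target then ⟨c.Φ.symm v, c.symm_mem h⟩ else c.base
  source := {x | (x : Y) ∈ c.Φ.source}
  target := {v | (v : Y) ∈ c.Φ.target}
  map_source' x hx := by
    have hx : (x : Y) ∈ c.Φ.source := hx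
    simp [c.coe_proj x.2 hx, c.Φ.map_source hx]
  map_target' v hv := by
    have hv : (v : Y) ∈ c.Φ.target := hv
    simp [hv, c.Φ.map_target hv]
  left_inv' x hx := by
    have hx : (x : Y) ∈ c.Φ.source := hx
    apply Subtype.ext
    simp [c.coe_proj x.2 hx, c.Φ.map_source hx, c.Φ.left_inv hx]
  right_inv' v hv := by
    have hv : (v : Y) ∈ c.Φ.target := hv
    simp [hv, c.Φ.right_inv hv, c.proj_coe]

theorem overlap (c d : SliceChart S) :
    (c.chart.symm.trans d.chart).source =
      (fun v : c.V => (v : Y)) ⁻¹' (c.Φ.target ∩ c.Φ.symm ⁻¹' d.Φ.source) := by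
  ext v
  by_cases hv : (v : Y) ∈ c.Φ.target <;> simp [chart, hv]

theorem transition_eq (c d : SliceChart S) {v : c.V} (hv : (v : Y) ∈ c.Φ.target) :
    (c.chart.symm.trans d.chart) v = d.proj (d.Φ (c.Φ.symm v)) := by
  simp [chart, hv]

end SliceChart

/-- The analytic Banach manifold structure of an analytic submanifold of `Y`, induced from `Y`. -/
def submanifoldAtlas [CompleteSpace Y] {S : Set Y} (hS : IsAnalyticSubmanifold S) :
    AnalyticAtlas S where
  Index := SliceChart S
  Model c := c.V
  completeSpace c := c.isClosed_V.completeSpace_coe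
  chart c := c.chart
  exists_chart x := by
    obtain ⟨c, rfl⟩ := hS x
    exact ⟨c, c.base_mem⟩
  isOpen_overlap c d := by
    rw [SliceChart.overlap]
    exact (c.Φ.symm.isOpen_inter_preimage d.Φ.open_source).preimage continuous_subtype_val
  analytic c d := by
    intro v hv
    rw [SliceChart.overlap] at hv
    have h0 : AnalyticAt ℝ (fun w : c.V => (w : Y)) v := c.V.subtypeL.analyticAt v
    have h1 : AnalyticAt ℝ (fun w : c.V => c.Φ.symm w) v :=
      (c.analytic_symm _ hv.1).comp_of_eq h0 rfl
    have h2 : AnalyticAt ℝ (fun w : c.V => d.Φ (c.Φ.symm w)) v :=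
      (d.analytic _ hv.2).comp_of_eq h1 rfl
    have h3 : AnalyticAt ℝ (fun w : c.V => d.proj (d.Φ (c.Φ.symm w))) v :=
      (d.proj.analyticAt _).comp_of_eq h2 rfl
    refine h3.congr ?_
    filter_upwards [(c.Φ.open_target.preimage continuous_subtype_val).mem_nhds hv.1] with w hw
    exact (c.transition_eq d hw).symm

end Submanifold

/-! The Grassmann manifold of a Banach space. -/

/-- The non-zero proper complemented subspaces of `X`. -/
@[ext]
structure Grassmannian (X : Type u) [NormedAddCommGroup X] [NormedSpace ℝ X] where
  carrier : Submodule ℝ X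
  ne_bot : carrier ≠ ⊥
  ne_top : carrier ≠ ⊤
  compl : carrier.ClosedComplemented

/-- The set of idempotents of `L(X)` other than `0` and the identity. -/
def idempotents (X : Type u) [NormedAddCommGroup X] [NormedSpace ℝ X] : Set (X →L[ℝ] X) :=
  {Q | Q ∘L Q = Q ∧ Q ≠ 0 ∧ Q ≠ ContinuousLinearMap.id ℝ X}

namespace Grassmannian

variable {X : Type u} [NormedAddCommGroup X] [NormedSpace ℝ X]

theorem isClosed (E : Grassmannian X) : IsClosed (E.carrier : Set X) := E.compl.isClosed

variable [CompleteSpace X]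

instance (E : Grassmannian X) : CompleteSpace E.carrier := E.isClosed.completeSpace_coe

/-- A pair of non-zero proper complemented subspaces that are complements of each other. -/
structure ComplPair (X : Type u) [NormedAddCommGroup X] [NormedSpace ℝ X] where
  E : Grassmannian X
  F : Grassmannian X
  isCompl : IsCompl E.carrier F.carrier

/-- If `E` and `F` are complements of each other, the continuous projection of `X` onto `E` along
`F`, as a map to `E`. -/
def proj (E F : Grassmannian X) (h : IsCompl E.carrier F.carrier) : X →L[ℝ] E.carrier :=
  E.carrier.projectionOntoL F.carrier (Submodule.IsCompl.isTopCompl_of_isClosed h E.isClosed F.isClosed)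

theorem proj_coe (E F : Grassmannian X) (h : IsCompl E.carrier F.carrier) (x : E.carrier) :
    proj E F h x = x :=
  Submodule.projectionOntoL_apply_left _ x

theorem proj_eq_zero_iff (E F : Grassmannian X) (h : IsCompl E.carrier F.carrier) (x : X) :
    proj E F h x = 0 ↔ x ∈ F.carrier :=
  Submodule.projectionOntoL_apply_eq_zero_iff _

theorem proj_add_proj (E F : Grassmannian X) (h : IsCompl E.carrier F.carrier) (x : X) :
    (proj E F h x : X) + proj F E h.symm x = x :=
  Submodule.projectionL_add_projectionL_eq_self
    (Submodule.IsCompl.isTopCompl_of_isClosed h E.isClosed F.isClosed) x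

/-- The map `I + T`, from `E` to `X`, where `T` is an operator from `E` to `F`. -/
def graphMap (E F : Grassmannian X) (T : E.carrier →L[ℝ] F.carrier) : E.carrier →L[ℝ] X :=
  E.carrier.subtypeL + F.carrier.subtypeL ∘L T

theorem proj_graphMap (c : ComplPair X) (T : c.E.carrier →L[ℝ] c.F.carrier) (x : c.E.carrier) :
    proj c.E c.F c.isCompl (graphMap c.E c.F T x) = x := by
  have h : proj c.E c.F c.isCompl (T x : X) = 0 := (proj_eq_zero_iff _ _ _ _).2 (T x).2
  simp [graphMap, proj_coe, h]

/-- The range of `I + T` is a complement of `F`. -/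
theorem isCompl_range_graphMap (c : ComplPair X) (T : c.E.carrier →L[ℝ] c.F.carrier) :
    IsCompl (graphMap c.E c.F T).range c.F.carrier := by
  refine IsCompl.of_eq ?_ ?_
  · rw [Submodule.eq_bot_iff]
    rintro _ ⟨⟨x, rfl⟩, hx⟩
    have h := (proj_eq_zero_iff _ _ c.isCompl _).2 hx
    have h' : x = 0 := by
      rw [← h]; exact (proj_graphMap c T x).symm
    simp [h']
  · rw [Submodule.eq_top_iff']
    intro y
    rw [Submodule.mem_sup]
    refine ⟨_, ⟨proj c.E c.F c.isCompl y, rfl⟩,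
      (proj c.F c.E c.isCompl.symm y - T (proj c.E c.F c.isCompl y) : c.F.carrier),
      Submodule.coe_mem _, ?_⟩
    have := proj_add_proj _ _ c.isCompl y
    conv_rhs => rw [← this]
    simp [graphMap]

/-- The subspace `(I + T)(E)`. -/
def graph (c : ComplPair X) (T : c.E.carrier →L[ℝ] c.F.carrier) : Grassmannian X where
  carrier := (graphMap c.E c.F T).range
  ne_bot h := by
    have := isCompl_range_graphMap c T
    rw [h] at this
    exact c.F.ne_top (by simpa using this.sup_eq_top)
  ne_top h := by
    have := isCompl_range_graphMap c T
    rw [h] at this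
    exact c.F.ne_bot (by simpa using this.inf_eq_bot)
  compl := by
    refine ⟨(graphMap c.E c.F T).rangeRestrict ∘L proj c.E c.F c.isCompl, ?_⟩
    rintro ⟨_, x, rfl⟩
    apply Subtype.ext
    exact congrArg (graphMap c.E c.F T) (proj_graphMap c T x)

open Classical in
/-- The chart attached to a pair `(E, F)`: it is defined on the set of all complements `G` of `F`,
and sends `(I + T)(E)` to `T`. Here `T` is computed as minus the restriction to `E` of the
projection onto `F` along `G`. -/
def chart (c : ComplPair X) :
    PartialEquiv (Grassmannian X) (c.E.carrier →L[ℝ] c.F.carrier) where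
  toFun G := if h : IsCompl G.carrier c.F.carrier then
    -(proj c.F G h.symm ∘L c.E.carrier.subtypeL) else 0
  invFun T := graph c T
  source := {G | IsCompl G.carrier c.F.carrier}
  target := Set.univ
  map_source' _ _ := Set.mem_univ _
  map_target' T _ := isCompl_range_graphMap c T
  left_inv' G hG := by
    have hG : IsCompl G.carrier c.F.carrier := hG
    have key : ∀ x : c.E.carrier,
        graphMap c.E c.F (-(proj c.F G hG.symm ∘L c.E.carrier.subtypeL)) x
          = (proj G c.F hG (x : X) : X) := by
      intro x
      have := proj_add_proj _ _ hG (x : X)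
      simp only [graphMap, add_apply, ContinuousLinearMap.comp_apply,
        neg_apply, Submodule.subtypeL_apply, Submodule.coe_neg]
      nth_rewrite 1 [← this]
      abel
    apply Grassmannian.ext
    simp only [hG, dif_pos, graph]
    apply le_antisymm
    · rintro _ ⟨x, rfl⟩
      have := key x
      change graphMap c.E c.F _ x ∈ _
      rw [this]
      exact Submodule.coe_mem _
    · intro y hy
      refine ⟨proj c.E c.F c.isCompl y, ?_⟩
      change graphMap c.E c.F _ _ = _
      rw [key]
      have h1 := proj_add_proj _ _ c.isCompl y
      have h2 : (proj c.E c.F c.isCompl y : X) = y - proj c.F c.E c.isCompl.symm y :=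
        eq_sub_of_add_eq h1
      have h3 : proj G c.F hG (proj c.F c.E c.isCompl.symm y : X) = 0 :=
        (proj_eq_zero_iff _ _ _ _).2 (Submodule.coe_mem _)
      rw [h2, map_sub, h3, sub_zero]
      exact congrArg Subtype.val (proj_coe G c.F hG ⟨y, hy⟩)
  right_inv' T _ := by
    have h := isCompl_range_graphMap c T
    have h' : IsCompl (graph c T).carrier c.F.carrier := h
    simp only [h', dif_pos]
    ext x
    have h1 : (x : X) = graphMap c.E c.F T x - T x := by simp [graphMap]
    have h2 : proj c.F (graph c T) h'.symm (graphMap c.E c.F T x) = 0 :=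
      (proj_eq_zero_iff _ _ _ _).2 ⟨x, rfl⟩
    simp only [neg_apply, ContinuousLinearMap.comp_apply,
      Submodule.subtypeL_apply]
    rw [h1, map_sub, h2, proj_coe]
    simp

/-- The map `E → E'` obtained from `I + T` by projecting onto `E'` along `F'`. -/
def baseMap (c d : ComplPair X) (T : c.E.carrier →L[ℝ] c.F.carrier) :
    c.E.carrier →L[ℝ] d.E.carrier :=
  proj d.E d.F d.isCompl ∘L graphMap c.E c.F T

theorem isCompl_graph_iff (c d : ComplPair X) (T : c.E.carrier →L[ℝ] c.F.carrier) :
    IsCompl (graph c T).carrier d.F.carrier ↔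
      baseMap c d T ∈ Set.range ((↑) : (c.E.carrier ≃L[ℝ] d.E.carrier) → _) := by
  constructor
  · intro h
    have hinj : (baseMap c d T).ker = ⊥ := by
      rw [Submodule.eq_bot_iff]
      intro x hx
      have h1 : graphMap c.E c.F T x ∈ d.F.carrier :=
        (proj_eq_zero_iff _ _ d.isCompl _).1 hx
      have h2 : graphMap c.E c.F T x = 0 :=
        Submodule.disjoint_def.1 h.disjoint _ ⟨x, rfl⟩ h1
      have h3 := proj_graphMap c T x
      rw [h2, map_zero] at h3
      exact h3.symm
    have hsurj : (baseMap c d T).range = ⊤ := by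
      rw [Submodule.eq_top_iff']
      intro y
      have hy : (y : X) ∈ (graph c T).carrier ⊔ d.F.carrier := by
        rw [h.sup_eq_top]; trivial
      obtain ⟨_, ⟨x, rfl⟩, f, hf, hxf⟩ := Submodule.mem_sup.1 hy
      refine ⟨x, ?_⟩
      have h1 : proj d.E d.F d.isCompl f = 0 := (proj_eq_zero_iff _ _ _ _).2 hf
      have h2 := congrArg (proj d.E d.F d.isCompl) hxf
      rw [map_add, h1, add_zero, proj_coe] at h2
      exact h2
    exact ⟨ContinuousLinearEquiv.ofBijective _ hinj hsurj, by ext; rfl⟩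
  · rintro ⟨e, he⟩
    have he' : ∀ x, proj d.E d.F d.isCompl (graphMap c.E c.F T x) = e x := fun x => by
      have := congrArg (fun f => f x) he
      exact this.symm
    refine IsCompl.of_eq ?_ ?_
    · rw [Submodule.eq_bot_iff]
      rintro _ ⟨⟨x, rfl⟩, hx⟩
      have h1 := (proj_eq_zero_iff _ _ d.isCompl _).2 hx
      have h2 : e x = 0 := (he' x).symm.trans h1
      have h3 : x = 0 := by simpa using h2
      simp [h3]
    · rw [Submodule.eq_top_iff']
      intro y
      rw [Submodule.mem_sup]
      refine ⟨graphMap c.E c.F T (e.symm (proj d.E d.F d.isCompl y)), ⟨_, rfl⟩,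
        y - graphMap c.E c.F T (e.symm (proj d.E d.F d.isCompl y)), ?_, by abel⟩
      rw [← proj_eq_zero_iff _ _ d.isCompl, map_sub, he']
      simp

theorem overlap (c d : ComplPair X) :
    ((chart c).symm.trans (chart d)).source =
      baseMap c d ⁻¹' Set.range ((↑) : (c.E.carrier ≃L[ℝ] d.E.carrier) → _) := by
  ext T
  rw [Set.mem_preimage, ← isCompl_graph_iff, PartialEquiv.trans_source]
  exact ⟨fun h => h.2, fun h => ⟨Set.mem_univ _, h⟩⟩

theorem analytic_graphMap (c : ComplPair X) :
    AnalyticOnNhd ℝ (fun T => graphMap c.E c.F T) Set.univ := by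
  intro T _
  exact analyticAt_const.add
    ((ContinuousLinearMap.compL ℝ c.E.carrier c.F.carrier X c.F.carrier.subtypeL).analyticAt T)

theorem analytic_baseMap (c d : ComplPair X) : AnalyticOnNhd ℝ (baseMap c d) Set.univ := by
  intro T _
  exact ((ContinuousLinearMap.compL ℝ c.E.carrier X d.E.carrier
    (proj d.E d.F d.isCompl)).analyticAt _).comp_of_eq (analytic_graphMap c T trivial) rfl

theorem transition_eq (c d : ComplPair X) (T : c.E.carrier →L[ℝ] c.F.carrier)
    (hT : T ∈ ((chart c).symm.trans (chart d)).source) :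
    ((chart c).symm.trans (chart d)) T =
      (proj d.F d.E d.isCompl.symm ∘L graphMap c.E c.F T) ∘L
        (baseMap c d T).inverse := by
  rw [overlap] at hT
  have hG := (isCompl_graph_iff c d T).2 hT
  obtain ⟨e, he⟩ := hT
  have he' : ∀ x, proj d.E d.F d.isCompl (graphMap c.E c.F T x) = e x := fun x => by
    have := congrArg (fun f => f x) he
    exact this.symm
  rw [← he, ContinuousLinearMap.inverse_equiv]
  have h0 : ((chart c).symm.trans (chart d)) T = chart d (graph c T) := rfl
  have key : graph c T = graph d ((proj d.F d.E d.isCompl.symm ∘L graphMap c.E c.F T) ∘L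
        (e.symm : d.E.carrier →L[ℝ] c.E.carrier)) := by
    have hk : ∀ x, graphMap d.E d.F ((proj d.F d.E d.isCompl.symm ∘L graphMap c.E c.F T) ∘L
        (e.symm : d.E.carrier →L[ℝ] c.E.carrier)) x = graphMap c.E c.F T (e.symm x) := by
      intro x
      have h1 := proj_add_proj _ _ d.isCompl (graphMap c.E c.F T (e.symm x))
      rw [he', e.apply_symm_apply] at h1
      rw [← h1]
      rfl
    apply Grassmannian.ext
    apply le_antisymm
    · rintro _ ⟨x, rfl⟩
      refine ⟨e x, ?_⟩
      have := hk (e x)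
      rw [e.symm_apply_apply] at this
      exact this
    · rintro _ ⟨x, rfl⟩
      exact ⟨e.symm x, (hk x).symm⟩
  rw [h0, key]
  exact (chart d).right_inv (Set.mem_univ _)

end Grassmannian

open Grassmannian in
/-- The Grassmann manifold of the Banach space `X`. -/
def grassmannAtlas (X : Type u) [NormedAddCommGroup X] [NormedSpace ℝ X] [CompleteSpace X] :
    AnalyticAtlas (Grassmannian X) where
  Index := ComplPair X
  Model c := c.E.carrier →L[ℝ] c.F.carrier
  chart c := chart c
  exists_chart E := by
    obtain ⟨q, hq, hEq⟩ := E.compl.exists_isClosed_isCompl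
    refine ⟨⟨E, ⟨q, ?_, ?_, ?_⟩, hEq⟩, hEq⟩
    · rintro rfl
      exact E.ne_top (by simpa using hEq.sup_eq_top)
    · rintro rfl
      exact E.ne_bot (by simpa using hEq.inf_eq_bot)
    · exact Submodule.ClosedComplemented.of_isCompl_isClosed hEq.symm hq E.isClosed
  isOpen_overlap c d := by
    rw [overlap]
    exact ContinuousLinearEquiv.isOpen.preimage
      (continuousOn_univ.1 (analytic_baseMap c d).continuousOn)
  analytic c d := by
    intro T hT
    have ho : IsOpen ((chart c).symm.trans (chart d)).source := by
      rw [overlap]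
      exact ContinuousLinearEquiv.isOpen.preimage
        (continuousOn_univ.1 (analytic_baseMap c d).continuousOn)
    have hT' := hT
    rw [overlap] at hT'
    obtain ⟨e, he⟩ := hT'
    have h0 : AnalyticAt ℝ (ContinuousLinearMap.inverse :
        (c.E.carrier →L[ℝ] d.E.carrier) → (d.E.carrier →L[ℝ] c.E.carrier)) e :=
      (contDiffAt_map_inverse e).analyticAt
    have h1 : AnalyticAt ℝ (fun S => (baseMap c d S).inverse) T :=
      h0.comp_of_eq (analytic_baseMap c d T trivial) he.symm
    have h2 : AnalyticAt ℝ
        (fun S => proj d.F d.E d.isCompl.symm ∘L graphMap c.E c.F S) T :=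
      ((ContinuousLinearMap.compL ℝ c.E.carrier X d.F.carrier
        (proj d.F d.E d.isCompl.symm)).analyticAt _).comp_of_eq
        (analytic_graphMap c T trivial) rfl
    have h3 : AnalyticAt ℝ (fun S => (proj d.F d.E d.isCompl.symm ∘L graphMap c.E c.F S) ∘L
        (baseMap c d S).inverse) T :=
      ((ContinuousLinearMap.compL ℝ d.E.carrier c.E.carrier d.F.carrier).analyticAt_bilinear
        _).comp_of_eq (h2.prod h1) rfl
    refine h3.congr ?_
    filter_upwards [ho.mem_nhds hT] with S hS
    exact (transition_eq c d S hS).symm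

/-! The tangent bundle of the Grassmann manifold of a Hilbert space. -/

section Hilbert

variable {K : Type u} [NormedAddCommGroup K] [InnerProductSpace ℝ K] [CompleteSpace K]

/-- The orthogonal complement. -/
def Grassmannian.orthogonal (E : Grassmannian K) : Grassmannian K where
  carrier := E.carrierᗮ
  ne_bot h := E.ne_top ((Submodule.orthogonal_eq_bot_iff).1 h)
  ne_top h := E.ne_bot ((Submodule.orthogonal_eq_top_iff _).1 h)
  compl := Submodule.ClosedComplemented.of_isCompl_isClosed
    E.carrier.isCompl_orthogonal.symm
    (Submodule.isClosed_orthogonal _) E.isClosed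

/-- The pair `(E, Eᗮ)`. -/
def Grassmannian.orthogonalPair (E : Grassmannian K) : Grassmannian.ComplPair K where
  E := E
  F := E.orthogonal
  isCompl := E.carrier.isCompl_orthogonal

/-- The chart attached to the pair `(E, Eᗮ)`. -/
def orthogonalIndex (E : Grassmannian K) : (grassmannAtlas K).Index := E.orthogonalPair

theorem mem_source_orthogonalIndex (E : Grassmannian K) :
    E ∈ ((grassmannAtlas K).chart (orthogonalIndex E)).source :=
  E.orthogonalPair.isCompl

/-- The identification of `L(E, Eᗮ)` with the tangent space of the Grassmann manifold at `E`: the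
operator `T` corresponds to the tangent vector whose coordinate in the chart attached to `(E, Eᗮ)`
is `T`, that is, to the velocity at `s = 0` of the curve `s ↦ (I + sT)(E)`. -/
def grassmannTangent (E : Grassmannian K) :
    (E.carrier →L[ℝ] E.carrierᗮ) ≃ₗ[ℝ] (grassmannAtlas K).TangentSpace E :=
  ((grassmannAtlas K).tangentCoord (orthogonalIndex E) (mem_source_orthogonalIndex E)).symm

end Hilbert

end

/-! An idempotent `Q` with range `E` is the identity on `E`, so it is determined by its restriction
`Eᗮ → E`, and that restriction is an arbitrary operator. Taking `T` to be its adjoint gives both the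
bijection and the affine fibres. The work lies in the submanifold property and in analyticity in
both directions.

Submanifold: near an idempotent `p`, replace the block diagonal part of `a` by that of `a² - a`. The
derivative at `p` is an involution, so this is a local bi-analytic map. It flattens the idempotents
because, by `mul_self_eq_of_diagPart_eq_zero`, near `p` the diagonal part of `a² - a` already
controls all of it.

Analyticity: everything is written in the algebra of operators on `K`, where sums, products,
adjoints and inverses of units are analytic. There the idempotent is the adjoint of `T` extended by
zero, plus `P_E` (`idem_eq`). If `R` is any idempotent with range `E`, then `P_E = R (R + R* - 1)⁻¹`
(`Grassmannian.orthProj_eq`). In the chart of a pair with second member `F`, a tangent vector `T`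
has coordinate `W = π T ρ`, where `π` is the projection onto `F` along `E` and `ρ` the projection
onto `E` along `F` (`fderiv_changeCoord_apply`, `grassmannTangent_coord`).

From the tangent bundle to idempotents, take for `R` the projection onto the graph of the base
coordinate along `F`; then `T` is recovered from `W` by `P_E` and `1 - P_E`. In the other direction,
`Q` itself gives `P_E` and `T`, and it remains to find the projection onto the range of `Q` along
the fixed `F` as an analytic function of `Q`. This is obtained by conjugating the projection at the
base point (`mul_eq_of_conj_idempotent`, `exists_isCompl_near`). -/

noncomputable section

/-! ### The analytic inverse function theorem. -/

section InverseFunction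

variable {Y : Type u} [NormedAddCommGroup Y] [NormedSpace ℝ Y] [CompleteSpace Y]

/-- The analytic inverse function theorem, on a neighbourhood contained in a given one. -/
theorem exists_analytic_openPartialHomeomorph {f : Y → Y} {a : Y} {U : Set Y}
    (hf : AnalyticOnNhd ℝ f Set.univ) (e : Y ≃L[ℝ] Y) (he : HasFDerivAt f (e : Y →L[ℝ] Y) a)
    (hU : IsOpen U) (ha : a ∈ U) :
    ∃ Φ : OpenPartialHomeomorph Y Y, (Φ : Y → Y) = f ∧ a ∈ Φ.source ∧ Φ.source ⊆ U ∧
      AnalyticOnNhd ℝ Φ.symm Φ.target := by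
  have hfa := hf a trivial
  have hs : HasStrictFDerivAt f (e : Y →L[ℝ] Y) a := by
    rw [← he.fderiv]; exact hfa.hasStrictFDerivAt
  let Ψ := hs.toOpenPartialHomeomorph f
  have hΨ : (Ψ : Y → Y) = f := hs.toOpenPartialHomeomorph_coe
  have haΨ : a ∈ Ψ.source := hs.mem_toOpenPartialHomeomorph_source
  have hsymm : AnalyticAt ℝ Ψ.symm (Ψ a) :=
    Ψ.analyticAt_symm' haΨ (by rw [hΨ]; exact hfa) (by rw [hΨ]; exact he.fderiv)
  have ho : IsOpen {y | AnalyticAt ℝ Ψ.symm y} := isOpen_analyticAt ℝ _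
  have hc : Continuous f := continuousOn_univ.1 hf.continuousOn
  -- Analyticity of the inverse is known only at the image of `a`. It is an open condition, so
  -- pulling it back along `f` and shrinking the source makes it hold on the whole target.
  refine ⟨Ψ.restrOpen (U ∩ f ⁻¹' {y | AnalyticAt ℝ Ψ.symm y}) (hU.inter (ho.preimage hc)),
    hΨ, ⟨haΨ, ha, ?_⟩, fun x hx => hx.2.1, ?_⟩
  · rw [hΨ] at hsymm; exact hsymm
  · intro y hy
    have h1 : y ∈ Ψ.target := hy.1
    have h2 : f (Ψ.symm y) ∈ {y | AnalyticAt ℝ Ψ.symm y} := hy.2.2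
    rw [← hΨ, Ψ.right_inv h1] at h2
    exact h2

end InverseFunction

/-! ### Idempotents of a Banach algebra form an analytic submanifold. -/

section Idempotent

variable {R : Type u} [NormedRing R] [NormedAlgebra ℝ R]

/-- The block diagonal part of an element with respect to an idempotent `p`. -/
def diagPart (p : R) : R →L[ℝ] R :=
  ContinuousLinearMap.mulLeftRight ℝ R p p + ContinuousLinearMap.mulLeftRight ℝ R (1 - p) (1 - p)

theorem diagPart_apply (p x : R) :
    diagPart p x = p * x * p + (1 - p) * x * (1 - p) := by
  simp only [diagPart, add_apply, ContinuousLinearMap.mulLeftRight_apply]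

theorem diagPart_diagPart {p : R} (hp : p * p = p) (x : R) :
    diagPart p (diagPart p x) = diagPart p x := by
  have hp' : ∀ y, p * (p * y) = p * y := fun y => by rw [← mul_assoc, hp]
  simp only [diagPart_apply]
  simp only [mul_add, add_mul, mul_sub, sub_mul, mul_assoc, one_mul, mul_one, hp, hp']
  abel

/-- The map which keeps the block off-diagonal part of `a` and replaces its diagonal part by that
of `a ^ 2 - a`. -/
def flattenIdempotents (p a : R) : R := a - diagPart p a + diagPart p (a * a - a)

theorem analytic_flattenIdempotents (p : R) :
    AnalyticOnNhd ℝ (flattenIdempotents p) Set.univ := by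
  intro a _
  have h (g : R → R) (hg : AnalyticAt ℝ g a) : AnalyticAt ℝ (fun x => diagPart p (g x)) a :=
    ((diagPart p).analyticAt _).comp_of_eq hg rfl
  exact (analyticAt_id.sub (h _ analyticAt_id)).add
    (h _ ((analyticAt_id.mul analyticAt_id).sub analyticAt_id))

theorem diagPart_flattenIdempotents {p : R} (hp : p * p = p) (a : R) :
    diagPart p (flattenIdempotents p a) = diagPart p (a * a - a) := by
  rw [flattenIdempotents, map_add, map_sub, diagPart_diagPart hp, diagPart_diagPart hp]
  simp

/-- The derivative of `flattenIdempotents p` at `p`. -/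
def flattenDeriv (p : R) (hp : p * p = p) : R ≃L[ℝ] R :=
  -- On diagonal blocks `x ↦ p x + x p - x` is `+1` on the `p`-corner and `-1` on the `(1 -
  -- p)`-corner; off-diagonal blocks are kept. The derivative is thus a reflection, its own inverse.
  let L : R →L[ℝ] R := ContinuousLinearMap.id ℝ R -
    (2 : ℝ) • ContinuousLinearMap.mulLeftRight ℝ R (1 - p) (1 - p)
  have hL : ∀ x, L (L x) = x := by
    intro x
    have h : (1 - p) * ((1 - p) * x * (1 - p)) * (1 - p) = (1 - p) * x * (1 - p) := by
      have hp' : ∀ y, p * (p * y) = p * y := fun y => by rw [← mul_assoc, hp]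
      simp only [mul_sub, sub_mul, mul_assoc, one_mul, mul_one, hp, hp']
      abel
    have hx : ∀ y, L y = y - (2 : ℝ) • ((1 - p) * y * (1 - p)) := fun y => by
      simp only [L, sub_apply, smul_apply, ContinuousLinearMap.id_apply,
        ContinuousLinearMap.mulLeftRight_apply]
    have h2 : (1 - p) * (x - (2 : ℝ) • ((1 - p) * x * (1 - p))) * (1 - p) =
        (1 - p) * x * (1 - p) - (2 : ℝ) • ((1 - p) * ((1 - p) * x * (1 - p)) * (1 - p)) := by
      rw [mul_sub (1 - p) x, sub_mul _ _ (1 - p), mul_smul_comm, smul_mul_assoc]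
    rw [hx, hx, h2, h]
    module
  ContinuousLinearEquiv.equivOfInverse L L hL hL

theorem hasFDerivAt_flattenIdempotents {p : R} (hp : p * p = p) :
    HasFDerivAt (flattenIdempotents p) (flattenDeriv p hp : R →L[ℝ] R) p := by
  have h1 : HasFDerivAt (fun a : R => a) (ContinuousLinearMap.id ℝ R) p := hasFDerivAt_id p
  have h2 := ((diagPart p).hasFDerivAt.comp p ((h1.mul' h1).sub h1))
  have h3 := (h1.sub ((diagPart p).hasFDerivAt (x := p))).add h2
  refine h3.congr_fderiv ?_
  ext x
  have : x - diagPart p x + diagPart p (p * x + x * p - x) =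
      x - (2 : ℝ) • ((1 - p) * x * (1 - p)) := by
    have hp' : ∀ y, p * (p * y) = p * y := fun y => by rw [← mul_assoc, hp]
    rw [two_smul]
    simp only [diagPart_apply]
    simp only [mul_add, add_mul, mul_sub, sub_mul, mul_assoc, one_mul, mul_one, hp, hp']
    abel
  exact this

/-- Near an idempotent `p`, an element is idempotent as soon as the block diagonal part of
`a ^ 2 - a` vanishes. -/
theorem mul_self_eq_of_diagPart_eq_zero {p a : R} (hp : p * p = p)
    (ha : 2 * ‖2 * p - 1‖ * ‖a - p‖ < 1) (h : diagPart p (a * a - a) = 0) : a * a = a := by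
  rw [diagPart_apply] at h
  have hab : a * (a * a - a) = (a * a - a) * a := by noncomm_ring
  generalize hb : a * a - a = b at h hab
  have hp' : ∀ y, p * (p * y) = p * y := fun y => by rw [← mul_assoc, hp]
  have h1 : p * b * p = 0 := by
    have h0 : p * (p * b * p + (1 - p) * b * (1 - p)) * p = p * b * p := by
      simp only [mul_add, add_mul, mul_sub, sub_mul, mul_assoc, one_mul, mul_one, hp, hp']
      abel
    rw [← h0, h, mul_zero, zero_mul]
  have h2 : p * b + b * p = b := by
    have h0 : p * b * p + (1 - p) * b * (1 - p) = b - (p * b + b * p) + 2 • (p * b * p) := by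
      noncomm_ring
    rw [h0, h1, smul_zero, add_zero, sub_eq_zero] at h
    exact h.symm
  -- Since `b` commutes with `a`, its commutator with `a - p` is `p b - b p`. Being off-diagonal,
  -- `b` is recovered from this by the symmetry `2 p - 1`. So `b` is bounded by a small multiple of
  -- itself and vanishes.
  have h3 : b = (2 * p - 1) * (b * (a - p) - (a - p) * b) := by
    have e1 : b * (a - p) - (a - p) * b = p * b - b * p := by
      rw [mul_sub, sub_mul, hab]; abel
    have e2 : (2 * p - 1) * (p * b - b * p) = p * b + b * p - 2 • (p * b * p) := by
      simp only [two_mul, two_smul, mul_sub, sub_mul, add_mul, mul_assoc, one_mul, hp']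
      abel
    rw [e1, e2, h1, h2, smul_zero, sub_zero]
  have h4 : ‖b‖ ≤ ‖2 * p - 1‖ * (‖b‖ * ‖a - p‖ + ‖a - p‖ * ‖b‖) := by
    conv_lhs => rw [h3]
    refine (norm_mul_le _ _).trans (mul_le_mul_of_nonneg_left ?_ (norm_nonneg _))
    exact (norm_sub_le _ _).trans (add_le_add (norm_mul_le _ _) (norm_mul_le _ _))
  have h5 : ‖b‖ * (1 - 2 * ‖2 * p - 1‖ * ‖a - p‖) ≤ 0 := by nlinarith
  have h6 : ‖b‖ = 0 := le_antisymm (nonpos_of_mul_nonpos_left h5 (by linarith)) (norm_nonneg _)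
  exact sub_eq_zero.1 (hb.trans (norm_eq_zero.1 h6))

theorem isAnalyticSubmanifold_setOf_idempotent [CompleteSpace R] :
    IsAnalyticSubmanifold {a : R | a * a = a ∧ a ≠ 0 ∧ a ≠ 1} := by
  rintro ⟨p, hp, hp0, hp1⟩
  -- The neighbourhood also avoids `0` and `1`, so that inside it membership in the set reduces to
  -- idempotency.
  have hU : IsOpen {a : R | 2 * ‖2 * p - 1‖ * ‖a - p‖ < 1 ∧ a ≠ 0 ∧ a ≠ 1} :=
    (isOpen_lt (f := fun a : R => 2 * ‖2 * p - 1‖ * ‖a - p‖) (by fun_prop)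
      continuous_const).inter (isOpen_ne.inter isOpen_ne)
  obtain ⟨Φ, hΦ, hpΦ, hΦU, hsymm⟩ := exists_analytic_openPartialHomeomorph
    (analytic_flattenIdempotents p) _ (hasFDerivAt_flattenIdempotents hp) hU
    (a := p) ⟨by simp, hp0, hp1⟩
  refine ⟨{ base := ⟨p, hp, hp0, hp1⟩
            Φ := Φ
            base_mem := hpΦ
            analytic := fun x _ => by rw [hΦ]; exact analytic_flattenIdempotents p x trivial
            analytic_symm := hsymm
            -- The diagonal part is itself a projection, so its kernel, the off-diagonal elements,
            -- is complemented by `1 - diagPart p`.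
            V := (diagPart p).ker
            proj := (ContinuousLinearMap.id ℝ R - diagPart p).codRestrict _ fun x => ?_
            proj_coe := fun v => ?_
            mem_iff := fun a ha => ?_ }, rfl⟩
  · simp [diagPart_diagPart hp]
  · apply Subtype.ext
    have : diagPart p (v : R) = 0 := v.2
    simp [this]
  · have haU := hΦU ha
    rw [hΦ]
    change _ ↔ diagPart p _ = 0
    rw [diagPart_flattenIdempotents hp]
    constructor
    · intro h
      rw [h.1, sub_self, map_zero]
    · intro h
      exact ⟨mul_self_eq_of_diagPart_eq_zero hp haU.1 h, haU.2⟩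

end Idempotent

theorem isAnalyticSubmanifold_idempotents (X : Type u) [NormedAddCommGroup X] [NormedSpace ℝ X]
    [CompleteSpace X] : IsAnalyticSubmanifold (idempotents X) :=
  isAnalyticSubmanifold_setOf_idempotent (R := X →L[ℝ] X)

/-! Analytic maps to and from a submanifold of a Banach space. -/

section Submanifold

variable {Y : Type u} [NormedAddCommGroup Y] [NormedSpace ℝ Y] [CompleteSpace Y] {S : Set Y}
  (hS : IsAnalyticSubmanifold S)

/-- A chart of the submanifold is a linear projection after an analytic map of the ambient space, so
analyticity can be tested in the ambient space. -/
theorem AnalyticAtlas.isAnalyticMap_submanifold_of_coe {M : Type u} (A : AnalyticAtlas M)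
    {f : M → S} (hf : ∀ i p, p ∈ (A.chart i).source →
      AnalyticAt ℝ (fun x => (f ((A.chart i).symm x) : Y)) (A.chart i p)) :
    A.IsAnalyticMap (submanifoldAtlas hS) f := by
  intro p i (c : SliceChart S) hp hc
  have hc : (f p : Y) ∈ c.Φ.source := hc
  have h := hf i p hp
  have hpi := (A.chart i).left_inv hp
  refine ⟨h.continuousAt.preimage_mem_nhds (c.Φ.open_source.mem_nhds ?_), ?_⟩
  · rw [hpi]; exact hc
  · have h1 : AnalyticAt ℝ (fun x => c.Φ (f ((A.chart i).symm x))) (A.chart i p) :=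
      (c.analytic _ hc).comp_of_eq h (by rw [hpi])
    exact (c.proj.analyticAt _).comp_of_eq h1 rfl

/-- The inverse of a slice chart is the restriction of an ambient analytic map, so composing it with
an analytic extension `F` suffices. The extension may depend on the point and on the target chart,
and matters only on `S`. -/
theorem AnalyticAtlas.isAnalyticMap_of_local_extension {N : Type u} (B : AnalyticAtlas N)
    {f : S → N} (hf : ∀ (p : S) (j : B.Index), f p ∈ (B.chart j).source →
      ∃ F : Y → B.Model j, AnalyticAt ℝ F p ∧
        ∀ᶠ y in 𝓝 (p : Y), ∀ h : y ∈ S,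
          f ⟨y, h⟩ ∈ (B.chart j).source ∧ B.chart j (f ⟨y, h⟩) = F y) :
    (submanifoldAtlas hS).IsAnalyticMap B f := by
  intro p (c : SliceChart S) j hp hj
  have hp : (p : Y) ∈ c.Φ.source := hp
  obtain ⟨F, hF, hev⟩ := hf p j hj
  change (∀ᶠ x in 𝓝 (c.chart p), f (c.chart.symm x) ∈ (B.chart j).source) ∧
    AnalyticAt ℝ (fun x => B.chart j (f (c.chart.symm x))) (c.chart p)
  have hcp : ((c.chart p : c.V) : Y) = c.Φ p := c.coe_proj p.2 hp
  have ht : ((c.chart p : c.V) : Y) ∈ c.Φ.target := by rw [hcp]; exact c.Φ.map_source hp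
  have h0 : AnalyticAt ℝ (fun w : c.V => c.Φ.symm w) (c.chart p) :=
    (c.analytic_symm _ ht).comp_of_eq (c.V.subtypeL.analyticAt _) rfl
  have e0 : c.Φ.symm ((c.chart p : c.V) : Y) = p := by rw [hcp, c.Φ.left_inv hp]
  have hev' : ∀ᶠ w in 𝓝 (c.chart p), f (c.chart.symm w) ∈ (B.chart j).source ∧
      B.chart j (f (c.chart.symm w)) = F (c.Φ.symm (w : c.V)) := by
    have h1 : Filter.Tendsto (fun w : c.V => c.Φ.symm w) (𝓝 (c.chart p)) (𝓝 (p : Y)) := by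
      have := h0.continuousAt.tendsto
      rwa [e0] at this
    filter_upwards [h1.eventually hev,
      (c.Φ.open_target.preimage continuous_subtype_val).mem_nhds ht] with w hw hwt
    have e : c.chart.symm w = ⟨c.Φ.symm w, c.symm_mem hwt⟩ := by
      simp only [SliceChart.chart, PartialEquiv.coe_symm_mk]
      exact dif_pos hwt
    rw [e]
    exact hw _
  refine ⟨hev'.mono fun w hw => hw.1, ?_⟩
  exact (hF.comp_of_eq h0 e0).congr (hev'.mono fun w hw => hw.2.symm)

end Submanifold

/-! ### Tools for differentiating changes of coordinates. -/

/-- The product rule applied to `f x (u x) = w x`. It gives the derivative of an operator-valued `f`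
known only through this relation, without a formula for `f` that involves inverses. -/
theorem fderiv_apply_add_apply {V G H : Type*} [NormedAddCommGroup V] [NormedSpace ℝ V]
    [NormedAddCommGroup G] [NormedSpace ℝ G] [NormedAddCommGroup H] [NormedSpace ℝ H]
    {f : V → G →L[ℝ] H} {u : V → G} {u' : V →L[ℝ] G} {w : V → H} {w' : V →L[ℝ] H} {a : V}
    (hf : DifferentiableAt ℝ f a) (hu : HasFDerivAt u u' a) (hw : HasFDerivAt w w' a)
    (h : ∀ᶠ x in 𝓝 a, f x (u x) = w x) (x : V) :
    fderiv ℝ f a x (u a) + f a (u' x) = w' x := by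
  have h1 := hf.hasFDerivAt.clm_apply hu
  rw [← h1.unique (hw.congr_of_eventuallyEq h)]
  simp [add_comm]

namespace AnalyticAtlas

variable {M : Type u} {A : AnalyticAtlas M} {i j : A.Index} {p : M}

theorem differentiableAt_transition (hi : p ∈ (A.chart i).source) (hj : p ∈ (A.chart j).source) :
    DifferentiableAt ℝ (A.transition i j) (A.chart i p) :=
  (analyticAt_transition hi hj).differentiableAt

theorem eventually_symm_mem (hi : p ∈ (A.chart i).source) (hj : p ∈ (A.chart j).source) :
    ∀ᶠ x in 𝓝 (A.chart i p), (A.chart i).symm x ∈ (A.chart j).source :=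
  Filter.Eventually.mono ((A.isOpen_overlap i j).mem_nhds (mem_overlap hi hj)) fun _ hx => hx.2

end AnalyticAtlas

/-! Oblique projections and the charts of the Grassmann manifold. -/

namespace Grassmannian

section Banach

variable {X : Type u} [NormedAddCommGroup X] [NormedSpace ℝ X] [CompleteSpace X]

theorem proj_eq_of_sub_mem (E F : Grassmannian X) (h : IsCompl E.carrier F.carrier) {x y : X}
    (hxy : x - y ∈ F.carrier) : proj E F h x = proj E F h y := by
  rw [← sub_eq_zero, ← map_sub]
  exact (proj_eq_zero_iff _ _ _ _).2 hxy

theorem coe_proj_eq (E F : Grassmannian X) (h : IsCompl E.carrier F.carrier) {x y : X}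
    (hy : y ∈ E.carrier) (hxy : x - y ∈ F.carrier) : (proj E F h x : X) = y := by
  rw [proj_eq_of_sub_mem E F h hxy]
  exact congrArg Subtype.val (proj_coe E F h ⟨y, hy⟩)

theorem sub_proj_mem (E F : Grassmannian X) (h : IsCompl E.carrier F.carrier) (x : X) :
    x - proj E F h x ∈ F.carrier := by
  rw [sub_eq_of_eq_add' (proj_add_proj E F h x).symm]
  exact Submodule.coe_mem _

theorem coe_proj_symm (E F : Grassmannian X) (h : IsCompl E.carrier F.carrier) (x : X) :
    (proj F E h.symm x : X) = x - proj E F h x :=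
  eq_sub_of_add_eq' (proj_add_proj E F h x)

/-- An operator which is the identity on its range `E` and has kernel `F` is the projection onto
`E` along `F`. -/
theorem exists_isCompl_of_projection (E F : Grassmannian X) (R : X →L[ℝ] X)
    (hmem : ∀ x, R x ∈ E.carrier) (hfix : ∀ x ∈ E.carrier, R x = x)
    (hker : ∀ x, R x = 0 ↔ x ∈ F.carrier) :
    ∃ h : IsCompl E.carrier F.carrier, ∀ x, (proj E F h x : X) = R x := by
  have hsub : ∀ x, x - R x ∈ F.carrier := fun x => by
    rw [← hker, map_sub, hfix _ (hmem x), sub_self]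
  have h : IsCompl E.carrier F.carrier := by
    refine IsCompl.of_eq ?_ ?_
    · rw [Submodule.eq_bot_iff]
      rintro x ⟨hE, hF⟩
      rw [← hfix x hE]
      exact (hker x).2 hF
    · rw [Submodule.eq_top_iff']
      intro x
      exact Submodule.mem_sup.2 ⟨R x, hmem x, x - R x, hsub x, by abel⟩
  exact ⟨h, fun x => coe_proj_eq E F h (hmem x) (hsub x)⟩

theorem chart_apply (c : ComplPair X) {G : Grassmannian X} (h : IsCompl G.carrier c.F.carrier)
    (x : c.E.carrier) : chart c G x = -proj c.F G h.symm (x : X) := by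
  have : chart c G = -(proj c.F G h.symm ∘L c.E.carrier.subtypeL) := dif_pos h
  rw [this]
  rfl

theorem proj_graph_apply (c : ComplPair X) (T : c.E.carrier →L[ℝ] c.F.carrier)
    (h : IsCompl (graph c T).carrier c.F.carrier) (x : X) :
    (proj (graph c T) c.F h x : X) = graphMap c.E c.F T (proj c.E c.F c.isCompl x) := by
  refine coe_proj_eq _ _ _ ⟨_, rfl⟩ ?_
  have := c.F.carrier.sub_mem (sub_proj_mem c.E c.F c.isCompl x)
    (T (proj c.E c.F c.isCompl x)).2
  simpa [graphMap, sub_sub] using this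

/-- The projection onto `F` along `G`, expressed by the coordinate of `G` in the chart. -/
theorem proj_eq_sub_chart (c : ComplPair X) {G : Grassmannian X}
    (h : IsCompl G.carrier c.F.carrier) (x : X) :
    proj c.F G h.symm x =
      proj c.F c.E c.isCompl.symm x - chart c G (proj c.E c.F c.isCompl x) := by
  rw [chart_apply c h, sub_neg_eq_add]
  conv_lhs => rw [← proj_add_proj c.E c.F c.isCompl x, map_add, proj_coe]
  exact add_comm _ _

omit [CompleteSpace X] in
theorem hasFDerivAt_graphMap (c : ComplPair X) (S : c.E.carrier →L[ℝ] c.F.carrier) :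
    HasFDerivAt (fun T => graphMap c.E c.F T)
      (ContinuousLinearMap.compL ℝ c.E.carrier c.F.carrier X c.F.carrier.subtypeL) S :=
  ((ContinuousLinearMap.compL ℝ c.E.carrier c.F.carrier X
    c.F.carrier.subtypeL).hasFDerivAt (x := S)).const_add c.E.carrier.subtypeL

omit [CompleteSpace X] in
theorem hasFDerivAt_comp_graphMap_apply (c : ComplPair X) {V : Type u} [NormedAddCommGroup V]
    [NormedSpace ℝ V] (A : X →L[ℝ] V) (S : c.E.carrier →L[ℝ] c.F.carrier) (y : c.E.carrier) :
    HasFDerivAt (fun T => A (graphMap c.E c.F T y))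
      ((A ∘L c.F.carrier.subtypeL) ∘L ContinuousLinearMap.apply ℝ c.F.carrier y) S := by
  have h1 := HasFDerivAt.clm_apply (E := c.E.carrier →L[ℝ] c.F.carrier)
    (G := c.E.carrier) (H := X) (hasFDerivAt_graphMap c S)
    (hasFDerivAt_const y S)
  refine (A.hasFDerivAt.comp S h1).congr_fderiv ?_
  ext T
  simp

/-- The change of coordinates from the chart `c` to the chart `d`. -/
def changeCoord (c d : ComplPair X) :
    (c.E.carrier →L[ℝ] c.F.carrier) → (d.E.carrier →L[ℝ] d.F.carrier) :=
  fun T => chart d ((chart c).symm T)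

theorem differentiableAt_changeCoord (c d : ComplPair X) (h : IsCompl c.E.carrier d.F.carrier) :
    DifferentiableAt ℝ (changeCoord c d) (chart c c.E) := by
  exact AnalyticAtlas.differentiableAt_transition (A := grassmannAtlas X) (i := c) (j := d)
    (p := c.E) c.isCompl h

theorem eventually_mem_overlap (c d : ComplPair X) (h : IsCompl c.E.carrier d.F.carrier) :
    ∀ᶠ T in 𝓝 (chart c c.E), IsCompl (graph c T).carrier d.F.carrier := by
  exact AnalyticAtlas.eventually_symm_mem (A := grassmannAtlas X) (i := c) (j := d)
    (p := c.E) c.isCompl h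

/-- The change of coordinates is determined by `F'`- and `E'`-components of `I + T`. -/
theorem changeCoord_baseMap (c d : ComplPair X) {T : c.E.carrier →L[ℝ] c.F.carrier}
    (h : IsCompl (graph c T).carrier d.F.carrier) (y : c.E.carrier) :
    changeCoord c d T (proj d.E d.F d.isCompl (graphMap c.E c.F T y)) =
      proj d.F d.E d.isCompl.symm (graphMap c.E c.F T y) := by
  have h0 : graphMap c.E c.F T y ∈ (graph c T).carrier := ⟨y, rfl⟩
  have h1 := proj_eq_sub_chart d h (graphMap c.E c.F T y)
  rw [(proj_eq_zero_iff _ _ _ _).2 h0] at h1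
  exact (sub_eq_zero.1 h1.symm).symm

theorem chart_self (c : ComplPair X) : chart c c.E = 0 := by
  ext x
  rw [chart_apply c c.isCompl, (proj_eq_zero_iff _ _ _ _).2 x.2]
  simp

/-- A tangent vector at `c.E` with coordinate `T` in the chart `c` has the coordinate
`W = π ∘ T ∘ ρ` in the chart `d`, where `π` is the projection onto `d.F` along `c.E` and `ρ` the
projection onto `c.E` along `d.F`. -/
theorem fderiv_changeCoord_apply (c d : ComplPair X) (h : IsCompl c.E.carrier d.F.carrier)
    (T : c.E.carrier →L[ℝ] c.F.carrier) (x : d.E.carrier) :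
    fderiv ℝ (changeCoord c d) (chart c c.E) T x =
      proj d.F c.E h.symm (T (proj c.E d.F h x) : X) := by
  have hval : changeCoord c d (chart c c.E) = chart d c.E :=
    congrArg (chart d) ((chart c).left_inv c.isCompl)
  -- This `y` in `c.E` is chosen so that its `d.E`-component is `x`; differentiating the relation
  -- along `y` then evaluates the derivative exactly at `x`.
  set y := proj c.E d.F h (x : X) with hy
  have hyx : proj d.E d.F d.isCompl (y : X) = x := by
    rw [← proj_eq_of_sub_mem d.E d.F d.isCompl (sub_proj_mem c.E d.F h (x : X)), proj_coe]
  have hev : ∀ᶠ S in 𝓝 (chart c c.E),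
      changeCoord c d S (proj d.E d.F d.isCompl (graphMap c.E c.F S y)) =
        proj d.F d.E d.isCompl.symm (graphMap c.E c.F S y) :=
    (eventually_mem_overlap c d h).mono fun S hS => changeCoord_baseMap c d hS y
  have h3 := fderiv_apply_add_apply (differentiableAt_changeCoord c d h)
    (hasFDerivAt_comp_graphMap_apply c (proj d.E d.F d.isCompl) _ y)
    (hasFDerivAt_comp_graphMap_apply c (proj d.F d.E d.isCompl.symm) _ y) hev T
  have h4 : graphMap c.E c.F (chart c c.E) y = y := by
    rw [chart_self]; simp [graphMap]
  simp only [ContinuousLinearMap.comp_apply, ContinuousLinearMap.apply_apply, Submodule.subtypeL_apply,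
    h4, hyx, hval] at h3
  -- The term from differentiating the argument is the chart value of `c.E` applied to the
  -- `d.E`-component of `T y`. Subtracting it turns the projection along `d.E` into the one along
  -- `c.E`.
  rw [proj_eq_sub_chart d h, ← h3, add_sub_cancel_right]

end Banach

/-! ### The idempotent attached to a tangent vector. -/

section Hilbert

variable {K : Type u} [NormedAddCommGroup K] [InnerProductSpace ℝ K] [CompleteSpace K]

/-- The coordinate of a tangent vector in the chart `c`, as an operator. -/
def tangentOperator (c : ComplPair K) {E : Grassmannian K} (h : IsCompl E.carrier c.F.carrier)
    (v : (grassmannAtlas K).TangentSpace E) : c.E.carrier →L[ℝ] c.F.carrier :=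
  v.1 ⟨c, h⟩

/-- By construction the coordinates of the vector are derivatives of the transitions from the chart
of `(E, Eᗮ)`, where it has coordinate `T`. -/
theorem grassmannTangent_coord (c : ComplPair K) {E : Grassmannian K}
    (h : IsCompl E.carrier c.F.carrier) (T : E.carrier →L[ℝ] E.carrierᗮ) (x : c.E.carrier) :
    tangentOperator c h (grassmannTangent E T) x =
      proj c.F E h.symm (T (proj E c.F h x) : K) :=
  fderiv_changeCoord_apply E.orthogonalPair c h T x

/-- The orthogonal projection onto `E`. -/
abbrev orthProj (E : Grassmannian K) : K →L[ℝ] K :=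
  E.carrier.subtypeL ∘L E.carrier.orthogonalProjectionOnto

theorem orthProj_mem (E : Grassmannian K) (x : K) : E.orthProj x ∈ E.carrier :=
  Submodule.coe_mem _

theorem orthProj_eq_self (E : Grassmannian K) {x : K} (hx : x ∈ E.carrier) : E.orthProj x = x :=
  Submodule.starProjection_eq_self_iff.2 hx

theorem star_orthProj (E : Grassmannian K) : star E.orthProj = E.orthProj := by
  rw [ContinuousLinearMap.star_eq_adjoint, orthProj, ContinuousLinearMap.adjoint_comp,
    Submodule.adjoint_subtypeL, Submodule.adjoint_orthogonalProjectionOnto]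

/-- The operator `T` from `E` to `Eᗮ`, extended by zero on `Eᗮ`. -/
def extendTangent (E : Grassmannian K) (T : E.carrier →L[ℝ] E.carrierᗮ) : K →L[ℝ] K :=
  E.carrierᗮ.subtypeL ∘L T ∘L E.carrier.orthogonalProjectionOnto

theorem extendTangent_apply (E : Grassmannian K) (T : E.carrier →L[ℝ] E.carrierᗮ)
    (x : E.carrier) : E.extendTangent T x = T x := by
  simp [extendTangent]

/-- The idempotent `T* P_{Eᗮ} + P_E`. -/
def idem (E : Grassmannian K) (T : E.carrier →L[ℝ] E.carrierᗮ) : K →L[ℝ] K :=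
  E.carrier.subtypeL ∘L ContinuousLinearMap.adjoint T ∘L E.carrierᗮ.orthogonalProjectionOnto
    + E.carrier.subtypeL ∘L E.carrier.orthogonalProjectionOnto

theorem idem_eq (E : Grassmannian K) (T : E.carrier →L[ℝ] E.carrierᗮ) :
    E.idem T = star (E.extendTangent T) + E.orthProj := by
  rw [ContinuousLinearMap.star_eq_adjoint, extendTangent, ContinuousLinearMap.adjoint_comp,
    ContinuousLinearMap.adjoint_comp, Submodule.adjoint_subtypeL,
    Submodule.adjoint_orthogonalProjectionOnto]
  rfl

/-- Recovers the tangent vector from its idempotent by algebraic operations on `K`; the inverse map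
rests on this. -/
theorem extendTangent_eq (E : Grassmannian K) (T : E.carrier →L[ℝ] E.carrierᗮ) :
    E.extendTangent T = star (E.idem T - E.orthProj) := by
  rw [idem_eq, add_sub_cancel_right, star_star]

theorem idem_mem (E : Grassmannian K) (T : E.carrier →L[ℝ] E.carrierᗮ) (x : K) :
    E.idem T x ∈ E.carrier :=
  E.carrier.add_mem (Submodule.coe_mem _) (Submodule.coe_mem _)

theorem idem_of_mem (E : Grassmannian K) (T : E.carrier →L[ℝ] E.carrierᗮ) {x : K}
    (hx : x ∈ E.carrier) : E.idem T x = x := by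
  have h1 : E.carrierᗮ.orthogonalProjectionOnto x = 0 :=
    Submodule.orthogonalProjectionOnto_orthogonal_apply_eq_zero hx
  have h2 : E.orthProj x = x := E.orthProj_eq_self hx
  simpa [idem, h1] using h2

theorem idem_of_mem_orthogonal (E : Grassmannian K) (T : E.carrier →L[ℝ] E.carrierᗮ)
    (x : E.carrierᗮ) : E.idem T x = ContinuousLinearMap.adjoint T x := by
  have h1 : E.carrier.orthogonalProjectionOnto (x : K) = 0 :=
    Submodule.orthogonalProjectionOnto_apply_of_mem_orthogonal x.2
  simp [idem, h1]

theorem range_idem (E : Grassmannian K) (T : E.carrier →L[ℝ] E.carrierᗮ) :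
    (E.idem T).range = E.carrier := by
  apply le_antisymm
  · rintro _ ⟨x, rfl⟩
    exact E.idem_mem T x
  · intro x hx
    exact ⟨x, E.idem_of_mem T hx⟩

theorem idem_mem_idempotents (E : Grassmannian K) (T : E.carrier →L[ℝ] E.carrierᗮ) :
    E.idem T ∈ idempotents K := by
  refine ⟨?_, fun h => E.ne_bot ?_, fun h => E.ne_top ?_⟩
  · ext x
    exact E.idem_of_mem T (E.idem_mem T x)
  · rw [← E.range_idem T, h]
    exact LinearMap.range_zero
  · rw [← E.range_idem T, h]
    exact LinearMap.range_id

theorem idem_injective (E : Grassmannian K) : Function.Injective E.idem := by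
  intro T T' h
  apply (ContinuousLinearMap.adjoint (𝕜 := ℝ)).injective
  ext x
  rw [← idem_of_mem_orthogonal, ← idem_of_mem_orthogonal, h]

theorem exists_idem_eq (E : Grassmannian K) {Q : K →L[ℝ] K} (hQ : Q ∘L Q = Q)
    (hE : Q.range = E.carrier) : ∃ T, E.idem T = Q := by
  have hmem : ∀ x, Q x ∈ E.carrier := fun x => by rw [← hE]; exact ⟨x, rfl⟩
  have hfix : ∀ x ∈ E.carrier, Q x = x := fun x hx => by
    rw [← hE] at hx
    obtain ⟨y, rfl⟩ := hx
    exact congrArg (fun A => A y) hQ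
  -- The restriction of `Q` to `Eᗮ` has to be `T*`. On `E` both operators are the identity, so
  -- comparing them on the two orthogonal components is enough.
  refine ⟨ContinuousLinearMap.adjoint (Q.codRestrict E.carrier hmem ∘L E.carrierᗮ.subtypeL), ?_⟩
  ext x
  have hx := E.carrier.starProjection_add_starProjection_orthogonal x
  rw [← hx, map_add, map_add]
  congr 1
  · have h1 : E.carrier.starProjection x ∈ E.carrier := Submodule.coe_mem _
    rw [idem_of_mem _ _ h1, hfix _ h1]
  · refine (E.idem_of_mem_orthogonal _ (E.carrierᗮ.orthogonalProjectionOnto x)).trans ?_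
    rw [ContinuousLinearMap.adjoint_adjoint]
    rfl

/-- The range of an idempotent. -/
def ofIdempotent (Q : idempotents K) : Grassmannian K where
  carrier := (Q : K →L[ℝ] K).range
  ne_bot h := Q.2.2.1 (by
    ext x
    have : (Q : K →L[ℝ] K) x ∈ (Q : K →L[ℝ] K).range := ⟨x, rfl⟩
    rw [h] at this
    exact this)
  ne_top h := Q.2.2.2 (by
    ext x
    have : x ∈ (Q : K →L[ℝ] K).range := by rw [h]; trivial
    obtain ⟨y, rfl⟩ := this
    exact congrArg (fun A => A y) Q.2.1)
  compl := by
    refine ⟨(Q : K →L[ℝ] K).rangeRestrict, ?_⟩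
    rintro ⟨_, y, rfl⟩
    exact Subtype.ext (congrArg (fun A => A y) Q.2.1)

end Hilbert

end Grassmannian

/-! ### Moving the range of an idempotent while keeping its kernel. -/

/-- If `q` and `q₁` are idempotents and `g = q q₁ + (1 - q) (1 - q₁)` and `n = g r₁ + (1 - r₁)` are
invertible, then conjugation by `n` moves the idempotent `r₁`, with the range of `q₁`, to an
idempotent with the range of `q` and the kernel of `r₁`. -/
theorem mul_eq_of_conj_idempotent {R : Type*} [Ring R] {q q₁ r₁ g n n' r : R} (hq : q * q = q)
    (hq₁ : q₁ * q₁ = q₁) (h1 : q₁ * r₁ = r₁) (h2 : r₁ * q₁ = q₁)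
    (hg : g = q * q₁ + (1 - q) * (1 - q₁)) (hn : n = g * r₁ + (1 - r₁)) (hgu : IsUnit g)
    (hnn' : n * n' = 1) (hn'n : n' * n = 1) (hr : r = n * r₁ * n') :
    q * r = r ∧ r * q = q ∧ r * r₁ = r ∧ r₁ * r = r₁ := by
  have hr₁ : r₁ * r₁ = r₁ := by rw [← h1, ← mul_assoc, mul_assoc q₁, h2, hq₁]
  -- By `e1` and `e2`, `n` acts as `g` on the range of `r₁` and as the identity on its kernel. By
  -- `e3` and `e4`, `g` intertwines `q₁` and `q`.
  have e1 : n * r₁ = g * r₁ := by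
    rw [hn, add_mul, sub_mul, one_mul, hr₁, sub_self, add_zero, mul_assoc, hr₁]
  have e2 : n * (1 - r₁) = 1 - r₁ := by
    have : r₁ * (1 - r₁) = 0 := by rw [mul_sub, mul_one, hr₁, sub_self]
    rw [hn, add_mul, mul_assoc, this, mul_zero, zero_add, sub_mul, one_mul, this, sub_zero]
  have e3 : g * q₁ = q * q₁ := by
    have : (1 - q₁) * q₁ = 0 := by rw [sub_mul, one_mul, hq₁, sub_self]
    rw [hg, add_mul, mul_assoc, hq₁, mul_assoc, this, mul_zero, add_zero]
  have e4 : q * g = q * q₁ := by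
    have : q * (1 - q) = 0 := by rw [mul_sub, mul_one, hq, sub_self]
    rw [hg, mul_add, ← mul_assoc, hq, ← mul_assoc, this, zero_mul, add_zero]
  have e5 : r * n = n * r₁ := by rw [hr, mul_assoc, hn'n, mul_one]
  have e6 : r * g * r₁ = g * r₁ := by
    rw [mul_assoc, ← e1, ← mul_assoc, e5, mul_assoc, hr₁]
  refine ⟨?_, ?_, ?_, ?_⟩
  · rw [hr, ← mul_assoc, e1, ← mul_assoc, e4, mul_assoc q, h1]
    rw [show g * r₁ = q * r₁ by rw [← h1, ← mul_assoc, e3, mul_assoc]]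
  -- The identity is checked after right multiplication by the unit `g`, where `q g = g q₁` and `r`
  -- fixes `g r₁`.
  · refine hgu.mul_left_injective ?_
    change r * q * g = q * g
    rw [mul_assoc, e4, ← e3, ← h2, ← mul_assoc, ← mul_assoc, e6, mul_assoc]
  · have : r * (1 - r₁) = 0 := by
      rw [← e2, ← mul_assoc, e5, mul_assoc, mul_sub, mul_one, hr₁, sub_self, mul_zero]
    rw [mul_sub, mul_one, sub_eq_zero] at this
    exact this.symm
  · have e7 : r₁ * n * r₁ = r₁ * n := by
      have : r₁ * n * (1 - r₁) = 0 := by rw [mul_assoc, e2, mul_sub, mul_one, hr₁, sub_self]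
      rw [mul_sub, mul_one, sub_eq_zero] at this
      exact this.symm
    rw [hr, ← mul_assoc, ← mul_assoc, e7, mul_assoc, hnn', mul_one]

theorem ContinuousLinearMap.map_analyticAt {V W Z : Type*} [NormedAddCommGroup V]
    [NormedSpace ℝ V] [NormedAddCommGroup W] [NormedSpace ℝ W] [NormedAddCommGroup Z]
    [NormedSpace ℝ Z] (L : W →L[ℝ] Z) {f : V → W} {a : V} (hf : AnalyticAt ℝ f a) :
    AnalyticAt ℝ (fun x => L (f x)) a :=
  (L.analyticAt _).comp_of_eq hf rfl

/-! ### Orthogonal projections as analytic functions of idempotents. -/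

section Hilbert

variable {K : Type u} [NormedAddCommGroup K] [InnerProductSpace ℝ K] [CompleteSpace K]

/-- The quadratic form of this operator is `‖x‖² + ‖D x‖²`, hence coercive with constant `1`. -/
theorem isUnit_one_add_star_mul_self (D : K →L[ℝ] K) : IsUnit (1 + star D * D) := by
  refine ContinuousLinearMap.isUnit_of_forall_le_norm_inner_map _ (c := 1) one_pos fun x => ?_
  have h : inner ℝ ((1 + star D * D) x) x = ‖x‖ ^ 2 + ‖D x‖ ^ 2 := by
    have h1 : (1 + star D * D) x = x + ContinuousLinearMap.adjoint D (D x) := rfl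
    rw [h1, inner_add_left, ContinuousLinearMap.adjoint_inner_left, real_inner_self_eq_norm_sq,
      real_inner_self_eq_norm_sq]
  rw [h, Real.norm_of_nonneg (by positivity), NNReal.coe_one, mul_one]
  exact le_add_of_nonneg_right (by positivity)

/-- Its square is `1 + D* D` with `D = R - R*`, a unit. -/
theorem isUnit_add_star_sub_one {R : K →L[ℝ] K} (hR : R * R = R) : IsUnit (R + star R - 1) := by
  have hR' : star R * star R = star R := by rw [← star_mul, hR]
  have h : (R + star R - 1) ^ 2 = 1 + star (R - star R) * (R - star R) := by
    have h1 : (R + star R - 1) ^ 2 = R * R + star R * star R + R * star R + star R * R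
      - 2 • R - 2 • star R + 1 := by noncomm_ring
    have h2 : star (R - star R) * (R - star R) =
        star R * R + R * star R - R * R - star R * star R := by
      rw [star_sub, star_star]; noncomm_ring
    rw [h1, h2, hR, hR']
    abel
  rw [← isUnit_pow_iff two_ne_zero, h]
  exact isUnit_one_add_star_mul_self _

/-- The orthogonal projection onto the range of the idempotent `R`. -/
def orthOfIdempotent (R : K →L[ℝ] K) : K →L[ℝ] K :=
  R * Ring.inverse (R + star R - 1)

/-- With `P` the orthogonal projection, `P R = R` and `R P = P`; the adjoint of the latter is `P R*
= P`. Hence `P (R + R* - 1) = R`, and the second factor is a unit. -/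
theorem Grassmannian.orthProj_eq (E : Grassmannian K) {R : K →L[ℝ] K}
    (hmem : ∀ x, R x ∈ E.carrier) (hfix : ∀ x ∈ E.carrier, R x = x) :
    E.orthProj = orthOfIdempotent R := by
  have h1 : E.orthProj * R = R := by
    ext x; exact E.orthProj_eq_self (hmem x)
  have h2 : R * E.orthProj = E.orthProj := by
    ext x; exact hfix _ (E.orthProj_mem x)
  have h3 : R * R = R := by
    ext x; exact hfix _ (hmem x)
  have h4 : E.orthProj * star R = E.orthProj := by
    have := congrArg star h2
    rwa [star_mul, star_orthProj] at this
  have h5 : E.orthProj * (R + star R - 1) = R := by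
    rw [mul_sub, mul_add, h1, h4, mul_one, add_sub_cancel_right]
  rw [orthOfIdempotent, ← h5, mul_assoc, h5, Ring.mul_inverse_cancel _ (isUnit_add_star_sub_one h3),
    mul_one]

theorem analyticAt_star (R : K →L[ℝ] K) : AnalyticAt ℝ (star : (K →L[ℝ] K) → K →L[ℝ] K) R :=
  ((starL' ℝ : (K →L[ℝ] K) ≃L[ℝ] (K →L[ℝ] K)) : (K →L[ℝ] K) →L[ℝ] (K →L[ℝ] K)).analyticAt R

theorem AnalyticAt.star_clm {V : Type*} [NormedAddCommGroup V] [NormedSpace ℝ V]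
    {f : V → K →L[ℝ] K} {a : V} (hf : AnalyticAt ℝ f a) : AnalyticAt ℝ (fun x => star (f x)) a :=
  (analyticAt_star _).comp_of_eq hf rfl

theorem AnalyticAt.ring_inverse {V A : Type*} [NormedAddCommGroup V] [NormedSpace ℝ V]
    [NormedRing A] [NormedAlgebra ℝ A] [CompleteSpace A] {f : V → A} {a : V}
    (hf : AnalyticAt ℝ f a) (h : IsUnit (f a)) : AnalyticAt ℝ (fun x => Ring.inverse (f x)) a :=
  (analyticAt_inverse h.unit).comp_of_eq hf rfl

theorem analyticAt_orthOfIdempotent {R : K →L[ℝ] K} (hR : R * R = R) :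
    AnalyticAt ℝ (orthOfIdempotent (K := K)) R :=
  analyticAt_id.mul (((analyticAt_id.add (analyticAt_star R)).sub analyticAt_const).ring_inverse
    (isUnit_add_star_sub_one hR))

/-! ### The bijection and its analyticity. -/

namespace Grassmannian

/-- The point of the tangent bundle `(E, T)` is sent to the idempotent `T* P_{Eᗮ} + P_E`. -/
def tangentIdem (x : (grassmannAtlas K).TangentBundle) : idempotents K :=
  ⟨x.1.idem ((grassmannTangent x.1).symm x.2), x.1.idem_mem_idempotents _⟩

theorem tangentIdem_bijective : Function.Bijective (tangentIdem (K := K)) := by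
  constructor
  · rintro ⟨E, v⟩ ⟨E', v'⟩ h
    have h : E.idem ((grassmannTangent E).symm v) = E'.idem ((grassmannTangent E').symm v') :=
      congrArg Subtype.val h
    have hE : E = E' := Grassmannian.ext (by rw [← E.range_idem, h, E'.range_idem])
    subst hE
    have hv := (grassmannTangent E).symm.injective (E.idem_injective h)
    rw [hv]
  · intro Q
    obtain ⟨T, hT⟩ := (ofIdempotent Q).exists_idem_eq Q.2.1 rfl
    refine ⟨⟨ofIdempotent Q, grassmannTangent _ T⟩, Subtype.ext ?_⟩
    simpa [tangentIdem] using hT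

/-- The bijection between the tangent bundle of the Grassmann manifold and the idempotents. -/
def tangentEquiv : (grassmannAtlas K).TangentBundle ≃ idempotents K :=
  Equiv.ofBijective tangentIdem tangentIdem_bijective

open Classical in
theorem tangentChart_apply (c : ComplPair K) (q : (grassmannAtlas K).TangentBundle)
    (h : IsCompl q.1.carrier c.F.carrier) :
    ((grassmannAtlas K).tangentChart c q : (c.E.carrier →L[ℝ] c.F.carrier) × _) =
      (chart c q.1, tangentOperator c h q.2) :=
  Prod.ext rfl (dif_pos h)

theorem tangentOperator_apply (c : ComplPair K) (q : (grassmannAtlas K).TangentBundle)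
    (h : IsCompl q.1.carrier c.F.carrier) (x : c.E.carrier) :
    tangentOperator c h q.2 x =
      proj c.F q.1 h.symm ((grassmannTangent q.1).symm q.2 (proj q.1 c.F h x) : K) := by
  conv_lhs => rw [← (grassmannTangent q.1).apply_symm_apply q.2]
  exact grassmannTangent_coord c h _ x

/-! The map `tangentEquiv` in charts. -/

/-- The projection onto `(I + S)(E)` along `F`. -/
def oblique (c : ComplPair K) (S : c.E.carrier →L[ℝ] c.F.carrier) : K →L[ℝ] K :=
  graphMap c.E c.F S ∘L proj c.E c.F c.isCompl

theorem oblique_chart (c : ComplPair K) {E : Grassmannian K} (h : IsCompl E.carrier c.F.carrier)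
    (x : K) : oblique c (chart c E) x = proj E c.F h x := by
  obtain ⟨S, rfl⟩ : ∃ S, E = graph c S := ⟨chart c E, ((chart c).left_inv h).symm⟩
  rw [show chart c (graph c S) = S from (chart c).right_inv (Set.mem_univ _),
    proj_graph_apply c S h]
  rfl

theorem oblique_mul_self (c : ComplPair K) (S : c.E.carrier →L[ℝ] c.F.carrier) :
    oblique c S * oblique c S = oblique c S := by
  ext x
  exact congrArg (graphMap c.E c.F S) (proj_graphMap c S _)

theorem analytic_oblique (c : ComplPair K) (S : c.E.carrier →L[ℝ] c.F.carrier) :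
    AnalyticAt ℝ (oblique c) S :=
  (((ContinuousLinearMap.compL ℝ K c.E.carrier K).flip
    (proj c.E c.F c.isCompl)).analyticAt _).comp_of_eq (analytic_graphMap c S trivial) rfl

/-- An operator from `E` to `F`, extended by zero on `F`. -/
def extend (c : ComplPair K) : (c.E.carrier →L[ℝ] c.F.carrier) →L[ℝ] (K →L[ℝ] K) :=
  ContinuousLinearMap.compL ℝ K c.F.carrier K c.F.carrier.subtypeL ∘L
    (ContinuousLinearMap.compL ℝ K c.E.carrier c.F.carrier).flip (proj c.E c.F c.isCompl)

theorem extend_apply (c : ComplPair K) (W : c.E.carrier →L[ℝ] c.F.carrier) (x : K) :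
    extend c W x = W (proj c.E c.F c.isCompl x) := rfl

/-- The coordinate expression of `tangentEquiv`. -/
def coordIdem (c : ComplPair K)
    (x : (c.E.carrier →L[ℝ] c.F.carrier) × (c.E.carrier →L[ℝ] c.F.carrier)) : K →L[ℝ] K :=
  star ((1 - orthOfIdempotent (oblique c x.1)) * extend c x.2 *
    orthOfIdempotent (oblique c x.1)) + orthOfIdempotent (oblique c x.1)

theorem analyticAt_coordIdem (c : ComplPair K)
    (x : (c.E.carrier →L[ℝ] c.F.carrier) × (c.E.carrier →L[ℝ] c.F.carrier)) :
    AnalyticAt ℝ (coordIdem c) x := by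
  have h1 : AnalyticAt ℝ (fun y : (c.E.carrier →L[ℝ] c.F.carrier) ×
      (c.E.carrier →L[ℝ] c.F.carrier) => oblique c y.1) x :=
    (analytic_oblique c x.1).comp_of_eq analyticAt_fst rfl
  have h2 := (analyticAt_orthOfIdempotent (oblique_mul_self c x.1)).comp_of_eq h1 rfl
  have h3 : AnalyticAt ℝ (fun y : (c.E.carrier →L[ℝ] c.F.carrier) ×
      (c.E.carrier →L[ℝ] c.F.carrier) => extend c y.2) x :=
    ContinuousLinearMap.map_analyticAt (W := c.E.carrier →L[ℝ] c.F.carrier) (Z := K →L[ℝ] K)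
      (extend c) analyticAt_snd
  exact (((analyticAt_const.sub h2).mul h3).mul h2).star_clm.add h2

/-- On `E`, the projection onto `c.E` along `F` is undone by the one onto `E` along `F`, so the
extension of `W` sends `y` in `E` to `T y` minus a vector of `E`. Multiplying by `1 - P_E` removes
that vector and fixes `T y`. -/
theorem extendTangent_eq_extend (c : ComplPair K) {E : Grassmannian K}
    (h : IsCompl E.carrier c.F.carrier) (T : E.carrier →L[ℝ] E.carrierᗮ)
    (W : c.E.carrier →L[ℝ] c.F.carrier)
    (hW : ∀ x, W x = proj c.F E h.symm (T (proj E c.F h x) : K)) :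
    E.extendTangent T = (1 - E.orthProj) * extend c W * E.orthProj := by
  ext x
  obtain ⟨y, hy, h1⟩ : ∃ y : E.carrier, (y : K) = E.orthProj x ∧ E.extendTangent T x = T y :=
    ⟨E.carrier.orthogonalProjectionOnto x, rfl, rfl⟩
  have h2 : proj E c.F h (proj c.E c.F c.isCompl (y : K) : K) = y := by
    rw [← proj_eq_of_sub_mem E c.F h (sub_proj_mem c.E c.F c.isCompl y), proj_coe]
  have h3 : extend c W (y : K) = (T y : K) - proj E c.F h (T y : K) := by
    rw [extend_apply, hW, h2, coe_proj_symm]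
  have h4 : E.orthProj (T y : K) = 0 :=
    congrArg Subtype.val (Submodule.orthogonalProjectionOnto_apply_of_mem_orthogonal (T y).2)
  have h5 := E.orthProj_eq_self (proj E c.F h (T y : K)).2
  rw [h1]
  change _ = extend c _ (E.orthProj x) - E.orthProj (extend c _ (E.orthProj x))
  rw [← hy, h3, map_sub, h4, h5]
  abel

theorem tangentIdem_eq_coordIdem (c : ComplPair K) (q : (grassmannAtlas K).TangentBundle)
    (h : IsCompl q.1.carrier c.F.carrier) :
    (tangentIdem q : K →L[ℝ] K) = coordIdem c (chart c q.1, tangentOperator c h q.2) := by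
  have hP : q.1.orthProj = orthOfIdempotent (oblique c (chart c q.1)) := by
    refine q.1.orthProj_eq (fun x => ?_) fun x hx => ?_
    · rw [oblique_chart c h]; exact Submodule.coe_mem _
    · rw [oblique_chart c h]; exact congrArg Subtype.val (proj_coe q.1 c.F h ⟨x, hx⟩)
  have hT := extendTangent_eq_extend c h _ _ (tangentOperator_apply c q h)
  rw [coordIdem, ← hP, ← hT]
  exact idem_eq _ _

theorem isAnalyticMap_tangentEquiv (hI : IsAnalyticSubmanifold (idempotents K)) :
    (grassmannAtlas K).tangentAtlas.IsAnalyticMap (submanifoldAtlas hI) tangentEquiv := by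
  refine AnalyticAtlas.isAnalyticMap_submanifold_of_coe hI _ fun (c : ComplPair K) p _ => ?_
  -- The chart target is the whole model space, so this equality of functions holds everywhere and
  -- not only near the point.
  have h : (fun x => (tangentEquiv (((grassmannAtlas K).tangentChart c).symm x) : K →L[ℝ] K)) =
      coordIdem c := by
    funext x
    have hx : x ∈ ((grassmannAtlas K).tangentChart c).target := ⟨Set.mem_univ _, Set.mem_univ _⟩
    have h1 := ((grassmannAtlas K).tangentChart c).map_target hx
    refine (tangentIdem_eq_coordIdem c _ h1).trans ?_
    rw [← tangentChart_apply c _ h1]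
    exact congrArg (coordIdem c) (((grassmannAtlas K).tangentChart c).right_inv hx)
  have := analyticAt_coordIdem c ((grassmannAtlas K).tangentChart c p)
  rw [← h] at this
  exact this

end Grassmannian

end Hilbert

/-! ### Analyticity of the inverse and affine fibres. -/

section Hilbert

variable {K : Type u} [NormedAddCommGroup K] [InnerProductSpace ℝ K] [CompleteSpace K]

namespace Grassmannian

/-- An operator on the whole space, compressed to an operator from `E` to `F`. -/
def compress (c : ComplPair K) : (K →L[ℝ] K) →L[ℝ] (c.E.carrier →L[ℝ] c.F.carrier) :=
  ContinuousLinearMap.compL ℝ c.E.carrier K c.F.carrier (proj c.F c.E c.isCompl.symm) ∘L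
    (ContinuousLinearMap.compL ℝ c.E.carrier K K).flip c.E.carrier.subtypeL

theorem compress_apply (c : ComplPair K) (A : K →L[ℝ] K) (x : c.E.carrier) :
    compress c A x = proj c.F c.E c.isCompl.symm (A x) := rfl

/-- The coordinates of the tangent vector corresponding to the idempotent `Q`, expressed by `Q` and
the projection `R` onto the range of `Q` along `F`. -/
def idemCoord (c : ComplPair K) (R Q : K →L[ℝ] K) :
    (c.E.carrier →L[ℝ] c.F.carrier) × (c.E.carrier →L[ℝ] c.F.carrier) :=
  (compress c R, compress c ((1 - R) * star (Q - orthOfIdempotent Q) * R))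

/-- Here `R` is `ρ` and `1 - R` is `π`, viewed as operators on `K`, so the product is `π T ρ` before
compression. -/
theorem compress_extendTangent (c : ComplPair K) {E : Grassmannian K}
    (h : IsCompl E.carrier c.F.carrier) (T : E.carrier →L[ℝ] E.carrierᗮ)
    (W : c.E.carrier →L[ℝ] c.F.carrier)
    (hW : ∀ x, W x = proj c.F E h.symm (T (proj E c.F h x) : K)) {R : K →L[ℝ] K}
    (hR : ∀ x, (proj E c.F h x : K) = R x) :
    compress c ((1 - R) * E.extendTangent T * R) = W := by
  ext1 x
  have hR' : ∀ x, (proj c.F E h.symm x : K) = (1 - R) x := fun x => by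
    rw [coe_proj_symm _ _ h, hR]; rfl
  rw [compress_apply, hW]
  change proj c.F c.E c.isCompl.symm ((1 - R) (E.extendTangent T (R x))) = _
  rw [← hR, extendTangent_apply, ← hR', proj_coe]

theorem tangentChart_eq_idemCoord (c : ComplPair K) (q : (grassmannAtlas K).TangentBundle)
    (h : IsCompl q.1.carrier c.F.carrier) {R : K →L[ℝ] K} (hR : ∀ x, (proj q.1 c.F h x : K) = R x) :
    (chart c q.1, tangentOperator c h q.2) = idemCoord c R (tangentIdem q : K →L[ℝ] K) := by
  have hP : q.1.orthProj = orthOfIdempotent (tangentIdem q : K →L[ℝ] K) :=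
    q.1.orthProj_eq (q.1.idem_mem _) fun _ hx => q.1.idem_of_mem _ hx
  refine Prod.ext ?_ ?_
  · ext1 x
    change chart c q.1 x = compress c R x
    -- On `c.E` the compression annihilates `x` itself, leaving minus the projection onto `F` along
    -- the range of `R`, which is the chart value.
    have h1 : R x = (x : K) - proj c.F q.1 h.symm (x : K) := by
      rw [coe_proj_symm _ _ h, hR, sub_sub_cancel]
    rw [chart_apply c h, compress_apply, h1, map_sub, proj_coe,
      (proj_eq_zero_iff c.F c.E c.isCompl.symm _).2 x.2, zero_sub]
  · change tangentOperator c h q.2 = compress c _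
    rw [← hP, show star ((tangentIdem q : K →L[ℝ] K) - q.1.orthProj) =
      q.1.extendTangent ((grassmannTangent q.1).symm q.2) from (extendTangent_eq _ _).symm]
    exact (compress_extendTangent c h _ _ (tangentOperator_apply c q h) hR).symm

/-- The element which conjugates the idempotent `Q₁` to the nearby idempotent `Q`. -/
def conjugator (Q₁ Q : K →L[ℝ] K) : K →L[ℝ] K := Q * Q₁ + (1 - Q) * (1 - Q₁)

/-- The element which conjugates the idempotent `R₁`, with the range of `Q₁`, to an idempotent with
the kernel of `R₁` and the range of the idempotent `Q` near `Q₁`. -/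
def obliqueConjugator (Q₁ R₁ Q : K →L[ℝ] K) : K →L[ℝ] K := conjugator Q₁ Q * R₁ + (1 - R₁)

omit [CompleteSpace K] in
theorem conjugator_self {Q : K →L[ℝ] K} (hQ : Q * Q = Q) : conjugator Q Q = 1 := by
  have : (1 - Q) * (1 - Q) = 1 - Q := by
    rw [show (1 - Q) * (1 - Q) = 1 - Q - Q + Q * Q by noncomm_ring, hQ, sub_add_cancel]
  rw [conjugator, hQ, this, add_sub_cancel]

omit [CompleteSpace K] in
theorem obliqueConjugator_self {Q : K →L[ℝ] K} (hQ : Q * Q = Q) (R : K →L[ℝ] K) :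
    obliqueConjugator Q R Q = 1 := by
  rw [obliqueConjugator, conjugator_self hQ, one_mul, add_sub_cancel]

omit [CompleteSpace K] in
theorem analyticAt_conjugator (Q₁ Q : K →L[ℝ] K) : AnalyticAt ℝ (conjugator Q₁) Q :=
  (analyticAt_id.mul analyticAt_const).add
    ((analyticAt_const.sub analyticAt_id).mul analyticAt_const)

omit [CompleteSpace K] in
theorem analyticAt_obliqueConjugator (Q₁ R₁ Q : K →L[ℝ] K) :
    AnalyticAt ℝ (obliqueConjugator Q₁ R₁) Q :=
  ((analyticAt_conjugator Q₁ Q).mul analyticAt_const).add analyticAt_const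

/-- The projection onto the range of `Q` along the kernel of `R₁`. -/
def obliqueNear (Q₁ R₁ Q : K →L[ℝ] K) : K →L[ℝ] K :=
  obliqueConjugator Q₁ R₁ Q * R₁ * Ring.inverse (obliqueConjugator Q₁ R₁ Q)

theorem analyticAt_obliqueNear {Q : K →L[ℝ] K} (hQ : Q * Q = Q) (R : K →L[ℝ] K) :
    AnalyticAt ℝ (obliqueNear Q R) Q :=
  ((analyticAt_obliqueConjugator Q R Q).mul analyticAt_const).mul
    ((analyticAt_obliqueConjugator Q R Q).ring_inverse
      (by rw [obliqueConjugator_self hQ]; exact isUnit_one))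

/-- The formula is used for all operators near `Q`, idempotent or not. At `Q` the inverted elements
are `1` and `Q + Q* - 1`, both units. -/
theorem analyticAt_idemCoord (c : ComplPair K) {Q : K →L[ℝ] K} (hQ : Q * Q = Q) (R : K →L[ℝ] K) :
    AnalyticAt ℝ (fun A => idemCoord c (obliqueNear Q R A) A) Q := by
  have h1 := analyticAt_obliqueNear hQ R
  have h2 : AnalyticAt ℝ (fun A => star (A - orthOfIdempotent A)) Q :=
    (analyticAt_id.sub (analyticAt_orthOfIdempotent hQ)).star_clm
  have h3 : AnalyticAt ℝ (fun A => (1 - obliqueNear Q R A) * star (A - orthOfIdempotent A) *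
      obliqueNear Q R A) Q := ((analyticAt_const.sub h1).mul h2).mul h1
  exact (ContinuousLinearMap.map_analyticAt (W := K →L[ℝ] K)
      (Z := c.E.carrier →L[ℝ] c.F.carrier) (compress c) h1).prod
    (ContinuousLinearMap.map_analyticAt (W := K →L[ℝ] K)
      (Z := c.E.carrier →L[ℝ] c.F.carrier) (compress c) h3)

theorem eventually_isUnit_conjugator {Q : K →L[ℝ] K} (hQ : Q * Q = Q) (R : K →L[ℝ] K) :
    ∀ᶠ A in 𝓝 Q, IsUnit (conjugator Q A) ∧ IsUnit (obliqueConjugator Q R A) := by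
  have h1 := (analyticAt_conjugator Q Q).continuousAt.preimage_mem_nhds
    (Units.isOpen.mem_nhds (by rw [conjugator_self hQ]; exact isUnit_one))
  have h2 := (analyticAt_obliqueConjugator Q R Q).continuousAt.preimage_mem_nhds
    (Units.isOpen.mem_nhds (by rw [obliqueConjugator_self hQ]; exact isUnit_one))
  filter_upwards [h1, h2] with A hA1 hA2
  exact ⟨hA1, hA2⟩

/-- Complementarity to `F` persists near `Q₁`: the conjugated idempotent has the range of `Q` and
still has kernel `F`, so its existence proves that the two subspaces are complements. -/
theorem exists_isCompl_near {E₁ E F : Grassmannian K} (h : IsCompl E₁.carrier F.carrier)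
    {Q₁ Q R₁ : K →L[ℝ] K} (hQ₁ : Q₁ * Q₁ = Q₁) (hQ : Q * Q = Q) (hE₁ : Q₁.range = E₁.carrier)
    (hE : Q.range = E.carrier) (hR₁ : R₁ = E₁.carrier.subtypeL ∘L proj E₁ F h)
    (hg : IsUnit (conjugator Q₁ Q)) (hn : IsUnit (obliqueConjugator Q₁ R₁ Q)) :
    ∃ h' : IsCompl E.carrier F.carrier, ∀ x, (proj E F h' x : K) = obliqueNear Q₁ R₁ Q x := by
  have hfix₁ : ∀ x ∈ E₁.carrier, Q₁ x = x := fun x hx => by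
    rw [← hE₁] at hx
    obtain ⟨y, rfl⟩ := hx
    exact congrArg (fun A => A y) hQ₁
  have e1 : Q₁ * R₁ = R₁ := by
    ext x
    rw [hR₁]
    exact hfix₁ _ (Submodule.coe_mem _)
  have e2 : R₁ * Q₁ = Q₁ := by
    ext x
    have hx : Q₁ x ∈ E₁.carrier := by rw [← hE₁]; exact ⟨x, rfl⟩
    rw [hR₁]
    exact congrArg Subtype.val (proj_coe E₁ F h ⟨_, hx⟩)
  obtain ⟨f1, f2, f3, f4⟩ := mul_eq_of_conj_idempotent hQ hQ₁ e1 e2 rfl rfl hg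
    (Ring.mul_inverse_cancel _ hn) (Ring.inverse_mul_cancel _ hn)
    (rfl : obliqueNear Q₁ R₁ Q = _)
  have hker : ∀ x, R₁ x = 0 ↔ x ∈ F.carrier := fun x => by
    rw [hR₁, ← proj_eq_zero_iff E₁ F h]
    exact Submodule.coe_eq_zero
  refine exists_isCompl_of_projection E F _ (fun x => ?_) (fun x hx => ?_) fun x => ?_
  · rw [← hE, ← f1]
    exact ⟨_, rfl⟩
  · rw [← hE] at hx
    obtain ⟨y, rfl⟩ := hx
    exact congrArg (fun A => A y) f2
  · rw [← hker]
    constructor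
    · intro hx
      have := congrArg (fun A => A x) f4
      rw [← this]
      change R₁ (obliqueNear Q₁ R₁ Q x) = 0
      rw [hx, map_zero]
    · intro hx
      have := congrArg (fun A => A x) f3
      rw [← this]
      change obliqueNear Q₁ R₁ Q (R₁ x) = 0
      rw [hx, map_zero]

theorem isAnalyticMap_tangentEquiv_symm (hI : IsAnalyticSubmanifold (idempotents K)) :
    (submanifoldAtlas hI).IsAnalyticMap (grassmannAtlas K).tangentAtlas tangentEquiv.symm := by
  refine AnalyticAtlas.isAnalyticMap_of_local_extension hI _ fun p (c : ComplPair K) hp => ?_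
  have hrange : ∀ Q : idempotents K,
      (Q : K →L[ℝ] K).range = (tangentEquiv.symm Q).1.carrier := fun Q => by
    have h := (tangentEquiv.symm Q).1.range_idem ((grassmannTangent _).symm (tangentEquiv.symm Q).2)
    rw [← h]
    exact congrArg (fun A : idempotents K => (A : K →L[ℝ] K).range)
      (tangentEquiv.apply_symm_apply Q).symm
  have hp : IsCompl (tangentEquiv.symm p).1.carrier c.F.carrier := hp
  have hpp : (p : K →L[ℝ] K) * p = p := p.2.1
  -- Only this base projection uses the splitting at `p`. Its kernel is the fixed `c.F`, so
  -- conjugating it gives the projections along `c.F` at nearby idempotents.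
  set R₁ : K →L[ℝ] K := (tangentEquiv.symm p).1.carrier.subtypeL ∘L
    proj (tangentEquiv.symm p).1 c.F hp with hR₁
  refine ⟨fun A => idemCoord c (obliqueNear (p : K →L[ℝ] K) R₁ A) A,
    analyticAt_idemCoord c hpp R₁, ?_⟩
  filter_upwards [eventually_isUnit_conjugator hpp R₁] with Q hQu hQ
  obtain ⟨h, hproj⟩ := exists_isCompl_near hp hpp hQ.1 (hrange p) (hrange ⟨Q, hQ⟩) hR₁ hQu.1 hQu.2
  refine ⟨h, ?_⟩
  have h1 : (tangentIdem (tangentEquiv.symm ⟨Q, hQ⟩) : K →L[ℝ] K) = Q :=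
    congrArg Subtype.val (tangentEquiv.apply_symm_apply ⟨Q, hQ⟩)
  have h2 := tangentChart_eq_idemCoord c _ h hproj
  rw [h1, ← tangentChart_apply] at h2
  exact h2

theorem extendTangent_add (E : Grassmannian K) (T T' : E.carrier →L[ℝ] E.carrierᗮ) :
    E.extendTangent (T + T') = E.extendTangent T + E.extendTangent T' := by
  ext x
  simp [extendTangent]

theorem extendTangent_smul (E : Grassmannian K) (a : ℝ) (T : E.carrier →L[ℝ] E.carrierᗮ) :
    E.extendTangent (a • T) = a • E.extendTangent T := by
  ext x
  simp [extendTangent]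

/-- The map `v ↦ T* P_{Eᗮ} + P_E` on the tangent space at `E`, as an affine map. -/
def idemAffine (E : Grassmannian K) : (grassmannAtlas K).TangentSpace E →ᵃ[ℝ] (K →L[ℝ] K) where
  toFun v := E.idem ((grassmannTangent E).symm v)
  -- The term `P_E` is the translation. Since the scalars are real, the adjoint is linear rather
  -- than conjugate-linear.
  linear :=
    { toFun v := star (E.extendTangent ((grassmannTangent E).symm v))
      map_add' v w := by rw [map_add, extendTangent_add, star_add]
      map_smul' a v := by
        rw [map_smul, extendTangent_smul, star_smul, star_trivial a, RingHom.id_apply] }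
  map_vadd' v w := by
    change E.idem ((grassmannTangent E).symm (w + v)) =
      star (E.extendTangent ((grassmannTangent E).symm w)) +
        E.idem ((grassmannTangent E).symm v)
    rw [idem_eq, idem_eq, map_add, extendTangent_add, star_add, add_assoc]

theorem range_idemAffine (E : Grassmannian K) :
    Set.range E.idemAffine = {Q | Q ∈ idempotents K ∧ Q.range = E.carrier} := by
  apply Set.Subset.antisymm
  · rintro _ ⟨v, rfl⟩
    exact ⟨E.idem_mem_idempotents _, E.range_idem _⟩
  · rintro Q ⟨hQ, hE⟩
    obtain ⟨T, hT⟩ := E.exists_idem_eq hQ.1 hE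
    refine ⟨grassmannTangent E T, ?_⟩
    change E.idem ((grassmannTangent E).symm (grassmannTangent E T)) = Q
    rw [LinearEquiv.symm_apply_apply, hT]

end Grassmannian

end Hilbert

end

theorem mainTheorem2 (K : Type u) [NormedAddCommGroup K] [InnerProductSpace ℝ K]
    [CompleteSpace K] :
    ∃ (hI : IsAnalyticSubmanifold (idempotents K))
      (Ψ : (grassmannAtlas K).TangentBundle ≃ idempotents K),
      (∀ (E : Grassmannian K) (T : E.carrier →L[ℝ] E.carrierᗮ),
        (Ψ ⟨E, grassmannTangent E T⟩ : K →L[ℝ] K) =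
          E.carrier.subtypeL ∘L ContinuousLinearMap.adjoint T ∘L
              E.carrierᗮ.orthogonalProjectionOnto
            + E.carrier.subtypeL ∘L E.carrier.orthogonalProjectionOnto) ∧
      (grassmannAtlas K).tangentAtlas.IsAnalyticMap (submanifoldAtlas hI) Ψ ∧
      (submanifoldAtlas hI).IsAnalyticMap (grassmannAtlas K).tangentAtlas Ψ.symm ∧
      ∀ E : Grassmannian K,
        ∃ Λ : (grassmannAtlas K).TangentSpace E →ᵃ[ℝ] (K →L[ℝ] K),
          (∀ v, (Ψ ⟨E, v⟩ : K →L[ℝ] K) = Λ v) ∧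
          Set.range Λ = {Q | Q ∈ idempotents K ∧ Q.range = E.carrier} := by
  refine ⟨isAnalyticSubmanifold_idempotents K, Grassmannian.tangentEquiv, fun E T => ?_,
    Grassmannian.isAnalyticMap_tangentEquiv _, Grassmannian.isAnalyticMap_tangentEquiv_symm _,
    fun E =>
    ⟨E.idemAffine, fun v => rfl, E.range_idemAffine⟩⟩
  change E.idem ((grassmannTangent E).symm (grassmannTangent E T)) = _
  rw [LinearEquiv.symm_apply_apply]
  rfl
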